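/- **Definitions.** All graphs are finite and simple, and $k\ge 2$. A *distance-$k$ independent set* of a graph is a set of vertices in which any two distinct vertices are at distance at least $k+1$; a *$k$-MDIS* is an inclusion-wise maximal one. An $n$-vertex tree is *$k$-minimal* if it has the minimum number of $k$-MDISs among all $n$-vertex trees. Let $f_k(n)=n$ for $n\le k+1$ and $$f_k(n)=n-\left\lfloor\frac{n-(k\bmod 2)}{\lfloor k/2\rfloor+1}\right\rfloor+1\qquad\text{for } n\ge k+2.$$ Let $N_k[v]$ be the set of vertices at distance at most $k$ from $v$. A vertex $u$ is a *$k$-twin* if $N_k[u]=N_k[v]$ for some vertex $v\ne u$. A leaf (vertex of degree $1$) of a tree is *diametral* if its eccentricity is maximum among all leaves; a *diametral $k$-twin* is a diametral leaf that is a $k$-twin. A *$k$-special pair* is a pair $(x,y)$ of diametral $k$-twins with $N_k[x]\ne N_k[y]$. For a tree $T$ with $m$ vertices and without diametral $k$-twins, and $r\ge 0$, let $\mathrm{Add}_k(T,r)$ (respectively $\mathrm{Add}^*_k(T,r)$) be the class of all trees with $m+r$ vertices that have the same diameter as $T$, contain $T$ as a subgraph, and contain no diametral $k$-twins (respectively no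 $k$-special pairs). Let $P_m$ be the path with $m$ vertices. Let $S_{p,m}$ be the tree obtained from $p$ disjoint copies of $P_m$ by adding one new vertex and joining it to one end of each copy, and let $S'_{p,m}$ be obtained from $S_{p,m}$ by deleting one leaf (for $p\ge 3$ and $m\ge 1$ the result does not depend on the leaf, up to isomorphism). **Theorem.** Let $k\ge 2$ be even and $n\ge 1$. The minimum number of $k$-MDISs over all $n$-vertex trees equals $f_k(n)$; that is, every $k$-minimal $n$-vertex tree has exactly $f_k(n)$ $k$-MDISs. Furthermore, up to isomorphism: (i) If $n\le k+1$, then all $n$-vertex trees are $k$-minimal; if $n=k+2$, then the path $P_{k+2}$ is the only $k$-minimal $n$-vertex tree. (ii) If $k+3\le n\le 3k/2+2$, then the class of all $k$-minimal $n$-vertex trees is $$\mathrm{Add}^*_k(P_{k+2},\,n-k-2)\ \cup\ \mathrm{Add}_k(P_{k+3},\,n-k-3).$$ (iii) If $n\ge 3k/2+3$, then the class of all $k$-minimal $n$-vertex trees is $\mathrm{Add}_k(S'_{p,k/2+1},\,r)$, where $p=\lfloor n/(k/2+1)\rfloor$ and $r=n \bmod (k/2+1)$. -/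

import Mathlib

/-- A distance-`k` independent set of a (connected) graph: any two distinct vertices of `J` are at
distance at least `k + 1`. -/
def IsDistIndep {V : Type*} (G : SimpleGraph V) (k : ℕ) (J : Set V) : Prop :=
  ∀ ⦃u v : V⦄, u ∈ J → v ∈ J → u ≠ v → k + 1 ≤ G.dist u v

/-- An inclusion-wise maximal distance-`k` independent set. -/
def IsMaxDistIndep {V : Type*} (G : SimpleGraph V) (k : ℕ) (J : Set V) : Prop :=
  Maximal (IsDistIndep G k) J

/-- The number of maximal distance-`k` independent sets of a finite graph. -/
noncomputable def mdi {V : Type*} (G : SimpleGraph V) (k : ℕ) : ℕ :=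
  {J : Set V | IsMaxDistIndep G k J}.ncard

/-- The function `f_k(n)`: it is `n` for `n ≤ k + 1` and
`n - ⌊(n - (k mod 2)) / (⌊k / 2⌋ + 1)⌋ + 1` otherwise (no subtraction truncates). -/
def minMdi (k n : ℕ) : ℕ :=
  if n ≤ k + 1 then n else n - (n - k % 2) / (k / 2 + 1) + 1

/-- `T` is a `k`-minimal tree: it is a tree with the least number of maximal distance-`k`
independent sets among all trees with the same number of vertices (each of these is isomorphic to a
tree on the vertex set of `T`). -/
def IsKMinimal {V : Type*} (T : SimpleGraph V) (k : ℕ) : Prop :=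
  T.IsTree ∧ ∀ T' : SimpleGraph V, T'.IsTree → mdi T k ≤ mdi T' k

/-- The closed `k`-neighbourhood `N_k[v]` in a connected graph. -/
def closedNbhd {V : Type*} (G : SimpleGraph V) (k : ℕ) (v : V) : Set V :=
  {u | G.dist v u ≤ k}

/-- `u` is a `k`-twin: some other vertex has the same closed `k`-neighbourhood. -/
def IsKTwin {V : Type*} (G : SimpleGraph V) (k : ℕ) (u : V) : Prop :=
  ∃ v, v ≠ u ∧ closedNbhd G k u = closedNbhd G k v

/-- A leaf: a vertex of degree one. -/
def IsLeafVertex {V : Type*} (G : SimpleGraph V) (v : V) : Prop :=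
  (G.neighborSet v).ncard = 1

/-- A diametral leaf: a leaf whose eccentricity is maximum among all leaves. -/
def IsDiametralLeaf {V : Type*} (G : SimpleGraph V) (v : V) : Prop :=
  IsLeafVertex G v ∧ ∀ w, IsLeafVertex G w → G.eccent w ≤ G.eccent v

/-- A diametral `k`-twin: a diametral leaf that is a `k`-twin. -/
def IsDiametralKTwin {V : Type*} (G : SimpleGraph V) (k : ℕ) (v : V) : Prop :=
  IsDiametralLeaf G v ∧ IsKTwin G k v

/-- A `k`-special pair: two diametral leaves that are both `k`-twins and have different closed
`k`-neighbourhoods. -/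
def IsKSpecialPair {V : Type*} (G : SimpleGraph V) (k : ℕ) (x y : V) : Prop :=
  IsDiametralKTwin G k x ∧ IsDiametralKTwin G k y ∧ closedNbhd G k x ≠ closedNbhd G k y

/-- `T'` belongs to the family `Add_k(T, r)`: `T'` is a tree with `r` more vertices than `T` and the
same diameter, it contains `T` as a (not necessarily induced) subgraph, and it has no diametral
`k`-twins. -/
def MemAdd {V W : Type*} [Finite V] [Finite W] (k : ℕ) (T : SimpleGraph V) (r : ℕ)
    (T' : SimpleGraph W) : Prop :=
  T'.IsTree ∧ Nat.card W = Nat.card V + r ∧ T'.diam = T.diam ∧ T.IsContained T' ∧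
    ∀ v, ¬ IsDiametralKTwin T' k v

/-- `T'` belongs to the family `Add*_k(T, r)`: `T'` is a tree with `r` more vertices than `T` and
the same diameter, it contains `T` as a (not necessarily induced) subgraph, and it has no
`k`-special pairs. -/
def MemAddStar {V W : Type*} [Finite V] [Finite W] (k : ℕ) (T : SimpleGraph V) (r : ℕ)
    (T' : SimpleGraph W) : Prop :=
  T'.IsTree ∧ Nat.card W = Nat.card V + r ∧ T'.diam = T.diam ∧ T.IsContained T' ∧
    ∀ x y, ¬ IsKSpecialPair T' k x y

/-- The spider `S_{p,m}`: a centre `none` and `p` paths, the `i`-th one having the `m` vertices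
`(i, 0), …, (i, m - 1)` in this order; the centre is adjacent to every `(i, 0)`. -/
def spider (p m : ℕ) : SimpleGraph (Option (Fin p × Fin m)) :=
  SimpleGraph.fromRel fun a b =>
    match a, b with
    | none, some (_, j) => (j : ℕ) = 0
    | some (i, j), some (i', j') => i = i' ∧ (j : ℕ) + 1 = j'
    | _, _ => False

/-- The vertices of `S_{p,m}` other than the leaf `(p - 1, m - 1)`, the end of the last path. -/
abbrev SpiderMinusVertex (p m : ℕ) : Type :=
  {v : Option (Fin p × Fin m) // ∀ i j, v = some (i, j) → ¬ ((i : ℕ) + 1 = p ∧ (j : ℕ) + 1 = m)}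

/-- The tree `S'_{p,m}` obtained from `S_{p,m}` (with `p, m ≥ 1`) by deleting the leaf at the end of
one of its paths. -/
def spiderMinus (p m : ℕ) : SimpleGraph (SpiderMinusVertex p m) :=
  (spider p m).comap Subtype.val

/-! Write k = 2h, and let M(S) be the number of maximal independent subsets of S. The lower bound is
proved for every geodesically convex S with at least h + 1 vertices: M(S) ≥ |S| + 1 - ⌊|S|/(h+1)⌋
(`card_lt_ncard_maxDistIndepIn_add`). If S has diameter at most k, every singleton is maximal.
Otherwise S is cut after the first h + 1 vertices of a longest path (`exists_cut`). The branch B cut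
off has depth at most h, hence diameter at most k, and at least h + 1 vertices. Restoring B creates
at least |B| - 1 new maximal sets (`ncard_maxDistIndepIn_union_branch`), while the quotient grows by
at least one.

For equality, diameter at most k gives n sets, diameter at least k + 3 makes the cut yield one more
set, and deleting a diametral twin that is far from two mutually close vertices loses at least two
sets. All of this exceeds the bound, so only diameters k + 1 and k + 2 survive. There the count is
exact: if L is independent and vertices outside L are pairwise within distance k, a maximal set
other than L has exactly one vertex outside L, which determines it
(`mdi_eq_of_isDistIndep_of_forall_dist_le`).

In diameter k + 1, L is a single non-twin end and the count is n - 1, optimal only while p =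
⌊n/(h+1)⌋ is 2. In diameter k + 2, L consists of all ends of longest paths, and the count is n - |L|
or n - |L| + 1. For p ≥ 3, optimality then amounts to p legs of length h + 1 around the centre, one
of them possibly shorter by one: a copy of S'_{p,h+1}. This spider with pendant vertices at its
centre also attains the bound. -/

namespace SimpleGraph

/-! ### Metric properties of trees -/

variable {V : Type*} {G : SimpleGraph V}

/-- A vertex at prescribed position on a shortest path. -/
lemma Connected.exists_dist_eq (hG : G.Connected) (u v : V) {t : ℕ} (ht : t ≤ G.dist u v) :
    ∃ w, G.dist u w = t ∧ t + G.dist w v = G.dist u v := by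
  obtain ⟨p, hp⟩ := hG.exists_walk_length_eq_dist u v
  have h1 : G.dist u (p.getVert t) ≤ t := by
    have := dist_le (p.take t)
    simp only [Walk.take_length] at this
    omega
  have h2 : G.dist (p.getVert t) v ≤ p.length - t := by
    have := dist_le (p.drop t)
    simp only [Walk.drop_length] at this
    omega
  have h3 := hG.dist_triangle (u := u) (v := p.getVert t) (w := v)
  exact ⟨p.getVert t, by omega, by omega⟩

/-- Distances across an edge of a tree add up. -/
lemma IsTree.dist_across (hG : G.IsTree) {u q b s : V} (huq : G.Adj u q)
    (hb : G.dist b q = G.dist b u + 1) (hs : G.dist s u = G.dist s q + 1) :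
    G.dist b s = G.dist b u + 1 + G.dist q s := by
  classical
  obtain ⟨p, hp, hpl⟩ := hG.connected.exists_path_of_dist b u
  obtain ⟨r, hr, hrl⟩ := hG.connected.exists_path_of_dist q s
  have key : ∀ {a c : V} (w : G.Walk a c), w.length = G.dist a c → ∀ z ∈ w.support,
      G.dist a z + G.dist z c = G.dist a c := by
    intro a c w hw z hz
    have h := congrArg Walk.length (w.take_spec hz)
    rw [Walk.length_append] at h
    have h1 := dist_le (w.takeUntil z hz)
    have h2 := dist_le (w.dropUntil z hz)
    have h3 := hG.connected.dist_triangle (u := a) (v := z) (w := c)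
    omega
  -- A common vertex would be strictly closer to `u` than to `q` because of `p`, and strictly closer
  -- to `q` than to `u` because of `r`.
  have hdisj : ∀ z, z ∈ p.support → z ∈ r.support → False := by
    intro z h1 h2
    have e1 := key p hpl z h1
    have e2 := key r hrl z h2
    have t1 := hG.connected.dist_triangle (u := b) (v := z) (w := q)
    have t2 := hG.connected.dist_triangle (u := s) (v := z) (w := u)
    have c1 := G.dist_comm (u := q) (v := z)
    have c2 := G.dist_comm (u := z) (v := s)
    have c3 := G.dist_comm (u := q) (v := s)
    omega
  have hpath : (p.append (Walk.cons huq r)).IsPath := by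
    rw [Walk.isPath_def, Walk.support_append, Walk.support_cons, List.tail_cons,
      List.nodup_append]
    exact ⟨hp.support_nodup, hr.support_nodup, fun a ha c hc hac => hdisj a ha (hac ▸ hc)⟩
  obtain ⟨w, hw, hwl⟩ := hG.connected.exists_path_of_dist b s
  have := (hG.existsUnique_path b s).unique hw hpath
  rw [← hwl, this, Walk.length_append, Walk.length_cons, hpl, hrl]
  omega

/-- The four-point condition in a tree. -/
lemma IsTree.four_point (hG : G.IsTree) (x y u v : V) :
    G.dist x y + G.dist u v ≤ max (G.dist x u + G.dist y v) (G.dist x v + G.dist y u) := by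
  induction hn : G.dist x y generalizing x with
  | zero =>
    have := hG.connected.dist_eq_zero_iff.1 hn
    subst this
    have := hG.connected.dist_triangle (u := u) (v := x) (w := v)
    rw [G.dist_comm (u := u) (v := x)] at this
    omega
  | succ n ih =>
    obtain ⟨x', h1, h2⟩ := hG.connected.exists_dist_eq x y (t := 1) (by omega)
    have hadj : G.Adj x x' := dist_eq_one_iff_adj.1 h1
    have := ih x' (by omega)
    -- A vertex behind `x`, as seen from `x'`, reaches `y` only through `x`; the claim is then the
    -- triangle inequality at `x`. If neither `u` nor `v` is behind `x`, both sides of the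
    -- inequality for `x'` grow by one.
    have across : ∀ w, G.dist w x' = G.dist w x + 1 → G.dist w y = G.dist w x + G.dist x y := by
      intro w hw
      have := hG.dist_across hadj hw (s := y) (by
        rw [G.dist_comm (u := y) (v := x), G.dist_comm (u := y) (v := x')]; omega)
      omega
    have c := fun a b => G.dist_comm (u := a) (v := b)
    rcases hG.dist_eq_dist_add_one_of_adj u hadj with hu | hu
    · rcases hG.dist_eq_dist_add_one_of_adj v hadj with hv | hv
      · rw [c u, c u] at hu
        rw [c v, c v] at hv
        omega
      · have h3 := across v hv
        have h4 := hG.connected.dist_triangle (u := u) (v := x) (w := v)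
        rw [c u x] at h4
        rw [c v x, c v y] at h3
        omega
    · have h3 := across u hu
      have h4 := hG.connected.dist_triangle (u := u) (v := x) (w := v)
      rw [c u x] at h4
      rw [c u x, c u y] at h3
      omega

/-- Trees are bipartite, so every triangle has even perimeter. -/
lemma IsTree.even_perimeter (hG : G.IsTree) (a b c : V) :
    Even (G.dist a b + G.dist b c + G.dist a c) := by
  induction hn : G.dist b c generalizing b with
  | zero =>
    have := hG.connected.dist_eq_zero_iff.1 hn
    subst this
    simp
  | succ n ih =>
    obtain ⟨b', h1, h2⟩ := hG.connected.exists_dist_eq b c (t := 1) (by omega)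
    have := ih b' (by omega)
    have hadj : G.Adj b b' := dist_eq_one_iff_adj.1 h1
    rcases hG.dist_eq_dist_add_one_of_adj a hadj with h | h
    · rw [h, show G.dist a b' + 1 + (n + 1) + G.dist a c = G.dist a b' + n + G.dist a c + 2 by ring]
      exact this.add even_two
    · rw [h] at this
      rw [show G.dist a b + (n + 1) + G.dist a c = G.dist a b + 1 + n + G.dist a c by ring]
      exact this

lemma Connected.exists_dist_walk (hG : G.Connected) (x y : V) :
    ∃ w : ℕ → V, w 0 = x ∧ w (G.dist x y) = y ∧
      ∀ s t, s ≤ t → t ≤ G.dist x y → G.dist (w s) (w t) = t - s := by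
  obtain ⟨p, hp⟩ := hG.exists_walk_length_eq_dist x y
  refine ⟨p.getVert, by simp, by rw [← hp]; simp, fun s t hst ht => ?_⟩
  have h1 : ∀ i ≤ G.dist x y, G.dist x (p.getVert i) ≤ i ∧ G.dist (p.getVert i) y ≤ p.length - i := by
    intro i hi
    have h1 := dist_le (p.take i)
    have h2 := dist_le (p.drop i)
    simp only [Walk.take_length, Walk.drop_length] at h1 h2
    omega
  have h2 : G.dist (p.getVert s) (p.getVert t) ≤ t - s := by
    have h := dist_le ((p.drop s).take (t - s))
    rw [Walk.take_length, Walk.drop_getVert, show s + (t - s) = t by omega] at h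
    omega
  have h3 := hG.dist_triangle (u := x) (v := p.getVert s) (w := y)
  have h4 := hG.dist_triangle (u := p.getVert s) (v := p.getVert t) (w := y)
  have := h1 s (by omega)
  have := h1 t ht
  omega

/-- A set of vertices is geodesically convex. -/
def IsGeodConvex (G : SimpleGraph V) (S : Set V) : Prop :=
  ∀ ⦃u v w : V⦄, u ∈ S → v ∈ S → G.dist u w + G.dist w v = G.dist u v → w ∈ S

/-- Removing an endpoint of a diametral path leaves a convex set. -/
lemma IsTree.isGeodConvex_compl_singleton (hG : G.IsTree) {x w : V}
    (hw : ∀ u v, G.dist u v ≤ G.dist x w) : G.IsGeodConvex {x}ᶜ := by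
  intro u v z hu hv huv hz
  obtain rfl : z = x := hz
  -- With `z` between `u` and `v`, and no distance above `G.dist z w`, this forces `z = u` or `z =
  -- v`.
  have h1 := hG.four_point u v z w
  have h2 := hw v w
  have h3 := hw u w
  have c := G.dist_comm (u := z) (v := v)
  have p1 := hG.connected.pos_dist_of_ne (u := u) (v := z) hu
  have p2 := hG.connected.pos_dist_of_ne (u := v) (v := z) hv
  omega

end SimpleGraph

/-- The maximal distance-`k` independent subsets of `S`, with distances measured in `G`. -/
def maxDistIndepIn {V : Type*} (G : SimpleGraph V) (k : ℕ) (S : Set V) : Set (Set V) :=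
  {J | Maximal (fun J => J ⊆ S ∧ IsDistIndep G k J) J}

/-! ### Counting maximal independent sets -/

section Counting

variable {V : Type*} {G : SimpleGraph V} {k : ℕ}

lemma mdi_eq_ncard_maxDistIndepIn_univ : mdi G k = (maxDistIndepIn G k Set.univ).ncard := by
  simp [mdi, maxDistIndepIn, IsMaxDistIndep]

lemma IsDistIndep.insert {J : Set V} (hJ : IsDistIndep G k J) {v : V}
    (hv : ∀ u ∈ J, k + 1 ≤ G.dist v u) : IsDistIndep G k (insert v J) := by
  rintro a b (rfl | ha) (rfl | hb) hab
  · exact absurd rfl hab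
  · exact hv b hb
  · rw [G.dist_comm]
    exact hv a ha
  · exact hJ ha hb hab

lemma IsDistIndep.mono {J K : Set V} (hJ : IsDistIndep G k J) (h : K ⊆ J) : IsDistIndep G k K :=
  fun _ _ ha hb hab => hJ (h ha) (h hb) hab

lemma IsDistIndep.singleton (v : V) : IsDistIndep G k {v} := by
  rintro a b rfl rfl hab
  exact absurd rfl hab

lemma mem_maxDistIndepIn_iff {S J : Set V} : J ∈ maxDistIndepIn G k S ↔
    J ⊆ S ∧ IsDistIndep G k J ∧ ∀ v ∈ S, v ∉ J → ∃ u ∈ J, G.dist v u ≤ k := by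
  constructor
  · rintro ⟨⟨h1, h2⟩, h3⟩
    refine ⟨h1, h2, fun v hv hvJ => ?_⟩
    by_contra! h
    exact hvJ (h3 ⟨Set.insert_subset hv h1, h2.insert fun u hu => h u hu⟩
      (Set.subset_insert v J) (Set.mem_insert v J))
  · rintro ⟨h1, h2, h3⟩
    refine ⟨⟨h1, h2⟩, fun K ⟨hKS, hK⟩ hJK v hv => ?_⟩
    by_contra hvJ
    obtain ⟨u, hu, hvu⟩ := h3 v (hKS hv) hvJ
    have := hK hv (hJK hu) (by rintro rfl; exact hvJ hu)
    omega

lemma eq_of_subset_of_mem_maxDistIndepIn {S J K : Set V} (hJ : J ∈ maxDistIndepIn G k S)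
    (hK : K ∈ maxDistIndepIn G k S) (h : J ⊆ K) : J = K :=
  h.antisymm (hJ.2 hK.1 h)

lemma exists_mem_maxDistIndepIn [Finite V] {S J : Set V} (hJS : J ⊆ S) (hJ : IsDistIndep G k J) :
    ∃ K ∈ maxDistIndepIn G k S, J ⊆ K := by
  obtain ⟨K, h1, h2⟩ := Finite.exists_le_maximal
    (p := fun J => J ⊆ S ∧ IsDistIndep G k J) ⟨hJS, hJ⟩
  exact ⟨K, h2, h1⟩

/-- Greedy maximal independent subsets of a decreasing family of sets can be chosen nested. -/
lemma exists_nested_maxDistIndepIn [Finite V] (N : ℕ) (X : ℕ → Set V) (hX : Antitone X) :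
    ∃ A : ℕ → Set V, (∀ t ≤ N, A t ∈ maxDistIndepIn G k (X t)) ∧
      ∀ s t, s ≤ t → t ≤ N → A t ⊆ A s := by
  induction N generalizing X with
  | zero =>
    obtain ⟨K, hK, -⟩ := exists_mem_maxDistIndepIn (G := G) (k := k) (Set.empty_subset (X 0))
      (fun _ _ h => h.elim)
    refine ⟨fun _ => K, fun t ht => ?_, fun _ _ _ _ => subset_rfl⟩
    obtain rfl : t = 0 := by omega
    exact hK
  | succ N ih =>
    -- The smaller sets are served first; their choice is then extended inside the largest set `X
    -- 0`.
    obtain ⟨A, h1, h2⟩ := ih (fun t => X (t + 1)) (fun s t hst => hX (by omega))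
    obtain ⟨K, hK, hAK⟩ := exists_mem_maxDistIndepIn (G := G) (k := k) (J := A 0) (S := X 0)
      ((h1 0 (by omega)).1.1.trans (hX (by omega))) (h1 0 (by omega)).1.2
    refine ⟨fun t => t.casesOn K A, fun t ht => ?_, fun s t hst ht => ?_⟩
    · cases t with
      | zero => exact hK
      | succ t => exact h1 t (by omega)
    · cases t with
      | zero =>
        obtain rfl : s = 0 := by omega
        exact subset_rfl
      | succ t =>
        cases s with
        | zero => exact (h2 0 t (by omega) (by omega)).trans hAK
        | succ s => exact h2 s t (by omega) (by omega)

/-- Adding a branch `B` of small diameter to `S` creates at least `|B| - 1` new maximal independent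
sets, and at least `|B|` if far vertices of `S` leave enough freedom. -/
lemma ncard_maxDistIndepIn_union_branch [Finite V] {S B : Set V} (hSB : Disjoint S B)
    (δ e : V → ℕ) (hd : ∀ b ∈ B, ∀ s ∈ S, G.dist b s = δ b + e s)
    (hB : ∀ b ∈ B, ∀ c ∈ B, G.dist b c ≤ k) :
    (maxDistIndepIn G k S).ncard + B.ncard ≤ (maxDistIndepIn G k (S ∪ B)).ncard + 1 ∧
    ∀ b₀ ∈ B, ∀ b₁ ∈ B, b₀ ≠ b₁ → δ b₁ ≤ δ b₀ → ∀ y ∈ S, ∀ z ∈ S, y ≠ z → G.dist y z ≤ k →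
      k + 1 ≤ δ b₁ + e y → k + 1 ≤ δ b₁ + e z →
      (maxDistIndepIn G k S).ncard + B.ncard ≤ (maxDistIndepIn G k (S ∪ B)).ncard := by
  classical
  have hdis : ∀ {v}, v ∈ S → v ∉ B := fun h1 h2 => Set.disjoint_left.1 hSB h1 h2
  -- For `b ∈ B`, the vertices of `S` at distance more than `k` from `b` form `X (k + 1 - δ b)`;
  -- when the subtraction truncates, this is all of `S`, as it should be.
  set X : ℕ → Set V := fun t => {s ∈ S | t ≤ e s} with hXdef
  have hX : Antitone X := fun s t hst v hv => ⟨hv.1, hst.trans hv.2⟩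
  have hXS : ∀ t, X t ⊆ S := fun t v hv => hv.1
  obtain ⟨A, hA, hAn⟩ := exists_nested_maxDistIndepIn (G := G) (k := k) (k + 1) X hX
  have hins : ∀ b ∈ B, ∀ C ∈ maxDistIndepIn G k (X (k + 1 - δ b)),
      insert b C ∈ maxDistIndepIn G k (S ∪ B) := by
    intro b hb C hC
    rw [mem_maxDistIndepIn_iff] at hC ⊢
    obtain ⟨h1, h2, h3⟩ := hC
    refine ⟨?_, h2.insert fun u hu => ?_, fun v hv hvC => ?_⟩
    · rintro v (rfl | hv)
      · exact Or.inr hb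
      · exact Or.inl (hXS _ (h1 hv))
    · have := (h1 hu).2
      rw [hd b hb u (h1 hu).1]
      omega
    · rw [Set.mem_insert_iff, not_or] at hvC
      rcases hv with hv | hv
      · by_cases hvX : v ∈ X (k + 1 - δ b)
        · obtain ⟨u, hu, huv⟩ := h3 v hvX hvC.2
          exact ⟨u, Or.inr hu, huv⟩
        · refine ⟨b, Or.inl rfl, ?_⟩
          have : ¬ (k + 1 - δ b ≤ e v) := fun h => hvX ⟨hv, h⟩
          rw [G.dist_comm, hd b hb v hv]
          omega
      · exact ⟨b, Or.inl rfl, hB v hv b hb⟩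
  have hres : ∀ b ∈ B, ∀ C ⊆ S, insert b C ∩ S = C := by
    intro b hb C hC
    ext v
    simp only [Set.mem_inter_iff, Set.mem_insert_iff]
    refine ⟨?_, fun h => ⟨Or.inr h, hC h⟩⟩
    rintro ⟨rfl | h, h'⟩
    · exact absurd hb (hdis h')
    · exact h
  have hinsinj : ∀ b ∈ B, ∀ C ⊆ S, ∀ c ∈ B, ∀ D ⊆ S, insert b C = insert c D → b = c := by
    intro b hb C hC c hc D hD h
    have hb' : b ∈ insert c D := h ▸ Set.mem_insert b C
    rcases hb' with hb' | hb'
    · exact hb'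
    · exact absurd hb (hdis (hD hb'))
  -- Any maximal extension `K` of `J` meets `S` exactly in `J`, since `J` is already maximal in `S`;
  -- so extensions of different sets differ.
  have hext : ∀ J, ∃ K, J ∈ maxDistIndepIn G k S → K ∈ maxDistIndepIn G k (S ∪ B) ∧ K ∩ S = J := by
    intro J
    by_cases hJ : J ∈ maxDistIndepIn G k S
    · obtain ⟨K, hK, hJK⟩ := exists_mem_maxDistIndepIn (G := G) (k := k) (S := S ∪ B)
        (hJ.1.1.trans Set.subset_union_left) hJ.1.2
      refine ⟨K, fun _ => ⟨hK, ?_⟩⟩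
      have hsub : J ⊆ K ∩ S := Set.subset_inter hJK hJ.1.1
      exact (hJ.2 ⟨Set.inter_subset_right, hK.1.2.mono Set.inter_subset_left⟩ hsub).antisymm hsub
    · exact ⟨J, fun h => absurd h hJ⟩
  choose ext hext using hext
  set P := ext '' maxDistIndepIn G k S with hP
  set f : V → Set V := fun b => insert b (A (k + 1 - δ b)) with hf
  have hAS : ∀ b, A (k + 1 - δ b) ⊆ S := fun b => (hA _ (by omega)).1.1.trans (hXS _)
  set Q := f '' B with hQ
  have hPc : P.ncard = (maxDistIndepIn G k S).ncard := by
    refine Set.InjOn.ncard_image fun J hJ K hK h => ?_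
    rw [← (hext J hJ).2, ← (hext K hK).2, h]
  have hQc : Q.ncard = B.ncard :=
    Set.InjOn.ncard_image fun b hb c hc h => hinsinj b hb _ (hAS b) c hc _ (hAS c) h
  have hPM : P ⊆ maxDistIndepIn G k (S ∪ B) := by
    rintro _ ⟨J, hJ, rfl⟩
    exact (hext J hJ).1
  have hQM : Q ⊆ maxDistIndepIn G k (S ∪ B) := by
    rintro _ ⟨b, hb, rfl⟩
    exact hins b hb _ (hA _ (by omega))
  -- A common member restricts to some `A t` that is maximal in all of `S`. Two such restrictions
  -- are nested, hence equal, and a member of `P` is determined by its restriction.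
  have hPQ : (P ∩ Q).ncard ≤ 1 := by
    rw [Set.ncard_le_one (Set.toFinite _)]
    rintro _ ⟨⟨J, hJ, rfl⟩, b, hb, hbJ⟩ _ ⟨⟨K, hK, rfl⟩, c, hc, hcK⟩
    have eJ : A (k + 1 - δ b) = J := by
      rw [← (hext J hJ).2, ← hbJ]
      exact (hres b hb _ (hAS b)).symm
    have eK : A (k + 1 - δ c) = K := by
      rw [← (hext K hK).2, ← hcK]
      exact (hres c hc _ (hAS c)).symm
    have : J = K := by
      rcases le_total (δ b) (δ c) with h | h
      · exact eq_of_subset_of_mem_maxDistIndepIn hJ hK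
          (eJ ▸ eK ▸ hAn _ _ (by omega) (by omega))
      · exact (eq_of_subset_of_mem_maxDistIndepIn hK hJ
          (eJ ▸ eK ▸ hAn _ _ (by omega) (by omega))).symm
    rw [this]
  have hcard := Set.ncard_union_add_ncard_inter P Q
  refine ⟨?_, fun b₀ hb₀ b₁ hb₁ hne hδ y hy z hz hyz hyzk hey hez => ?_⟩
  · have := Set.ncard_le_ncard (Set.union_subset hPM hQM)
    omega
  -- `A (k + 1 - δ b₀)` misses `y` or `z`, which are too close to coexist. A set `C` through the
  -- missing vertex differs from every `A t` with `t` in the relevant range, because these are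
  -- contained in `A (k + 1 - δ b₀)`.
  obtain ⟨C, hC, hCne⟩ : ∃ C ∈ maxDistIndepIn G k (X (k + 1 - δ b₁)),
      ∀ t ≤ k + 1 - δ b₁, A t = C → k + 1 - δ b₀ ≤ t → False := by
    have : ∀ w ∈ S, k + 1 ≤ δ b₁ + e w → w ∉ A (k + 1 - δ b₀) →
        ∃ C ∈ maxDistIndepIn G k (X (k + 1 - δ b₁)),
          ∀ t ≤ k + 1 - δ b₁, A t = C → k + 1 - δ b₀ ≤ t → False := by
      intro w hw hew hwA
      obtain ⟨C, hC, hwC⟩ := exists_mem_maxDistIndepIn (G := G) (k := k) (J := {w})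
        (S := X (k + 1 - δ b₁))
        (Set.singleton_subset_iff.2 ⟨hw, by omega⟩) (IsDistIndep.singleton w)
      refine ⟨C, hC, fun t ht htC hle => hwA ?_⟩
      exact hAn _ _ hle (by omega) (htC ▸ hwC rfl)
    by_cases hyA : y ∈ A (k + 1 - δ b₀)
    · refine this z hz hez fun hzA => ?_
      have := (hA (k + 1 - δ b₀) (by omega)).1.2 hyA hzA hyz
      omega
    · exact this y hy hey hyA
  have hCS : C ⊆ S := hC.1.1.trans (hXS _)
  have hnQ : ∀ b ∈ B, δ b₁ ≤ δ b → δ b ≤ δ b₀ → insert b C ∉ Q := by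
    rintro b hb h1 h0 ⟨c, hc, hcb⟩
    obtain rfl := hinsinj c hc _ (hAS c) b hb _ hCS hcb
    refine hCne (k + 1 - δ c) (by omega) ?_ (by omega)
    rw [← hres c hc _ (hAS c), ← hres c hc _ hCS]
    exact congrArg (· ∩ S) hcb
  have hnP : ∀ b ∈ B, insert b C ∈ P → C ∈ maxDistIndepIn G k S ∧ insert b C = ext C := by
    rintro b hb ⟨J, hJ, hJb⟩
    have : J = C := by rw [← (hext J hJ).2, hJb, hres b hb _ hCS]
    subst this
    exact ⟨hJ, hJb.symm⟩
  -- If `insert b₁ C` lies in `P`, then `C` is maximal in `S` and this is its chosen extension; so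
  -- `insert b₀ C` is maximal too and was not chosen.
  obtain ⟨K, hKM, hKPQ⟩ : ∃ K ∈ maxDistIndepIn G k (S ∪ B), K ∉ P ∪ Q := by
    by_cases h1 : insert b₁ C ∈ P
    · obtain ⟨hCM, h1e⟩ := hnP b₁ hb₁ h1
      refine ⟨insert b₀ C, hins b₀ hb₀ C ?_, ?_⟩
      · rw [mem_maxDistIndepIn_iff] at hCM ⊢
        exact ⟨hC.1.1.trans (hX (by omega)), hCM.2.1, fun v hv => hCM.2.2 v (hXS _ hv)⟩
      · rintro (h | h)
        · exact hne (hinsinj b₀ hb₀ C hCS b₁ hb₁ C hCS ((hnP b₀ hb₀ h).2.trans h1e.symm))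
        · exact hnQ b₀ hb₀ hδ le_rfl h
    · refine ⟨insert b₁ C, hins b₁ hb₁ C hC, ?_⟩
      rintro (h | h)
      · exact h1 h
      · exact hnQ b₁ hb₁ le_rfl hδ h
  have h1 := Set.ncard_le_ncard (Set.insert_subset hKM (Set.union_subset hPM hQM))
  rw [Set.ncard_insert_of_notMem hKPQ] at h1
  omega

/-- If the independent set `L` meets every pair of vertices at distance more than `k`, then all
maximal independent sets except possibly `L` correspond to the vertices outside of `L`. -/
lemma mdi_eq_of_isDistIndep_of_forall_dist_le [Finite V] {L : Set V} (hL : IsDistIndep G k L)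
    (hLc : ∀ u v, u ∉ L → v ∉ L → G.dist u v ≤ k) :
    mdi G k = Lᶜ.ncard + ({J | J = L ∧ J ∈ maxDistIndepIn G k Set.univ} : Set (Set V)).ncard := by
  -- A maximal set not inside `L` has just one vertex `v` outside `L`, and by maximality contains
  -- every vertex of `L` far from `v`.
  set f : V → Set V := fun v => insert v {l ∈ L | k + 1 ≤ G.dist v l} with hf
  have hfL : ∀ v ∉ L, ∀ w ∈ f v, w ∉ L → w = v := by
    rintro v hv w (rfl | hw) hwL
    · rfl
    · exact absurd hw.1 hwL
  have hinj : Set.InjOn f Lᶜ := fun v hv w hw h =>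
    hfL w hw v (h ▸ Set.mem_insert v _) hv
  have hsplit : maxDistIndepIn G k Set.univ =
      f '' Lᶜ ∪ {J | J = L ∧ J ∈ maxDistIndepIn G k Set.univ} := by
    ext J
    constructor
    · intro hJ
      by_cases hJL : J ⊆ L
      · right
        exact ⟨hJL.antisymm (hJ.2 ⟨Set.subset_univ _, hL⟩ hJL), hJ⟩
      · left
        obtain ⟨v, hvJ, hvL⟩ := Set.not_subset.1 hJL
        refine ⟨v, hvL, ?_⟩
        have hsub : J ⊆ f v := by
          intro w hw
          by_cases hwv : w = v
          · exact Or.inl hwv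
          · have h1 := hJ.1.2 hvJ hw (Ne.symm hwv)
            by_cases hwL : w ∈ L
            · exact Or.inr ⟨hwL, h1⟩
            · have := hLc v w hvL hwL
              omega
        refine (hJ.2 ⟨Set.subset_univ _, ?_⟩ hsub).antisymm hsub
        exact (hL.mono (Set.sep_subset _ _)).insert fun u hu => hu.2
    · rintro (⟨v, hv, rfl⟩ | h)
      · rw [mem_maxDistIndepIn_iff]
        refine ⟨Set.subset_univ _, (hL.mono (Set.sep_subset _ _)).insert fun u hu => hu.2,
          fun w _ hw => ⟨v, Or.inl rfl, ?_⟩⟩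
        by_cases hwL : w ∈ L
        · by_contra! h
          rw [G.dist_comm] at h
          exact hw (Or.inr ⟨hwL, h⟩)
        · exact hLc w v hwL hv
      · exact h.2
  have hdisj : Disjoint (f '' Lᶜ) {J | J = L ∧ J ∈ maxDistIndepIn G k Set.univ} := by
    rw [Set.disjoint_left]
    rintro _ ⟨v, hv, rfl⟩ h
    exact hv (h.1 ▸ Set.mem_insert v _)
  rw [mdi_eq_ncard_maxDistIndepIn_univ, congrArg Set.ncard hsplit, Set.ncard_union_eq hdisj,
    hinj.ncard_image]

/-- Deleting a vertex `x` with a `k`-twin deletes all maximal independent sets containing `x`. -/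
lemma ncard_maxDistIndepIn_compl_singleton_of_twin [Finite V] {x y a b : V} (hxy : y ≠ x)
    (htw : closedNbhd G k x = closedNbhd G k y) (ha : k + 1 ≤ G.dist x a)
    (hb : k + 1 ≤ G.dist x b) (hab : a ≠ b) (habk : G.dist a b ≤ k) :
    (maxDistIndepIn G k {x}ᶜ).ncard + 2 ≤ mdi G k := by
  have hxx : G.dist y x ≤ k := by
    have : x ∈ closedNbhd G k x := by simp [closedNbhd]
    rw [htw] at this
    exact this
  have htw' : ∀ v, G.dist x v ≤ k ↔ G.dist y v ≤ k := fun v => by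
    have := Set.ext_iff.1 htw v
    exact this
  -- Maximality survives the return of `x`: whatever is within distance `k` of its twin `y` is
  -- within distance `k` of `x`.
  have hext : maxDistIndepIn G k {x}ᶜ ⊆ maxDistIndepIn G k Set.univ := by
    intro J hJ
    rw [mem_maxDistIndepIn_iff] at hJ ⊢
    refine ⟨Set.subset_univ _, hJ.2.1, fun v _ hvJ => ?_⟩
    by_cases hv : v = x
    · subst hv
      by_cases hyJ : y ∈ J
      · exact ⟨y, hyJ, by rw [G.dist_comm]; exact hxx⟩
      · obtain ⟨u, hu, hyu⟩ := hJ.2.2 y hxy hyJ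
        exact ⟨u, hu, (htw' u).2 hyu⟩
    · exact hJ.2.2 v hv hvJ
  -- Two further sets contain `x`: one through `a`, one through `b`. They differ because `a` and `b`
  -- are close.
  have hpair : ∀ c, k + 1 ≤ G.dist x c → ∃ K ∈ maxDistIndepIn G k Set.univ, x ∈ K ∧ c ∈ K := by
    intro c hc
    obtain ⟨K, hK, hsub⟩ := exists_mem_maxDistIndepIn (G := G) (k := k) (J := insert x {c})
      (Set.subset_univ _) ((IsDistIndep.singleton c).insert (by rintro u rfl; exact hc))
    exact ⟨K, hK, hsub (Or.inl rfl), hsub (Or.inr rfl)⟩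
  obtain ⟨K, hK, hxK, haK⟩ := hpair a ha
  obtain ⟨K', hK', hxK', hbK'⟩ := hpair b hb
  have hne : K ≠ K' := by
    rintro rfl
    have := hK.1.2 haK hbK' hab
    omega
  have hsub : maxDistIndepIn G k {x}ᶜ ∪ {K, K'} ⊆ maxDistIndepIn G k Set.univ := by
    rintro J (hJ | rfl | rfl)
    · exact hext hJ
    · exact hK
    · exact hK'
  have hdisj : Disjoint (maxDistIndepIn G k {x}ᶜ) {K, K'} := by
    rw [Set.disjoint_left]
    rintro J hJ (rfl | rfl)
    · exact hJ.1.1 hxK rfl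
    · exact hJ.1.1 hxK' rfl
  have := Set.ncard_le_ncard hsub
  rw [Set.ncard_union_eq hdisj, Set.ncard_pair hne] at this
  rwa [mdi_eq_ncard_maxDistIndepIn_univ]

end Counting

/-! ### Lower bound for trees and exact counts in diameters `k + 1` and `k + 2` -/

section TreeBounds

open SimpleGraph

variable {V : Type*} {G : SimpleGraph V} {k h : ℕ}

/-- Cutting off the last `h` levels at one end of a longest path inside a convex set. -/
lemma SimpleGraph.IsTree.exists_cut [Finite V] (hG : G.IsTree) (hk : k = 2 * h) {S : Set V}
    (hS : G.IsGeodConvex S) {x y : V} (hx : x ∈ S) (hy : y ∈ S)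
    (hmax : ∀ u ∈ S, ∀ v ∈ S, G.dist u v ≤ G.dist x y) (hD : k + 1 ≤ G.dist x y) :
    ∃ S' B : Set V, Disjoint S' B ∧ S = S' ∪ B ∧ G.IsGeodConvex S' ∧ h + 1 ≤ B.ncard ∧
      h + 1 ≤ S'.ncard ∧
      (maxDistIndepIn G k S').ncard + B.ncard ≤ (maxDistIndepIn G k S).ncard + 1 ∧
      (1 ≤ h → k + 3 ≤ G.dist x y →
        (maxDistIndepIn G k S').ncard + B.ncard ≤ (maxDistIndepIn G k S).ncard) := by
  obtain ⟨w, hw0, hwD, hw⟩ := hG.connected.exists_dist_walk x y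
  set D := G.dist x y with hDdef
  have tri := fun a b c => hG.connected.dist_triangle (u := a) (v := b) (w := c)
  have comm := fun a b => G.dist_comm (u := a) (v := b)
  have hwS : ∀ t ≤ D, w t ∈ S := by
    intro t ht
    apply hS hx hy
    have h1 := hw 0 t (by omega) ht
    have h2 := hw t D ht le_rfl
    rw [hw0] at h1
    rw [hwD] at h2
    omega
  have hwinj : ∀ s ≤ D, ∀ t ≤ D, w s = w t → s = t := by
    intro s hs t ht hst
    rcases le_total s t with hle | hle
    · have := hw s t hle ht
      rw [hst, dist_self] at this
      omega
    · have := hw t s hle hs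
      rw [hst, dist_self] at this
      omega
  set u := w h with hu
  set q := w (h + 1) with hq
  have huq : G.Adj u q := by
    rw [← dist_eq_one_iff_adj, hu, hq, hw h (h + 1) (by omega) (by omega)]
    omega
  -- `B` and `S'` are the two sides of the edge `uq` within `S`.
  set B : Set V := {b ∈ S | G.dist b q = G.dist b u + 1} with hBdef
  set S' : Set V := {s ∈ S | G.dist s u = G.dist s q + 1} with hS'def
  have hBS : ∀ b ∈ B, ∀ s ∈ S', G.dist b s = G.dist b u + 1 + G.dist q s :=
    fun b hb s hs => hG.dist_across huq hb.2 hs.2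
  have hdisj : Disjoint S' B := by
    rw [Set.disjoint_left]
    rintro v ⟨_, h1⟩ ⟨_, h2⟩
    omega
  have hunion : S = S' ∪ B := by
    ext v
    constructor
    · intro hv
      rcases hG.dist_eq_dist_add_one_of_adj v huq with h1 | h1
      · exact Or.inl ⟨hv, h1⟩
      · exact Or.inr ⟨hv, h1⟩
    · rintro (hv | hv) <;> exact hv.1
  have hwB : ∀ t ≤ h, w t ∈ B := by
    intro t ht
    refine ⟨hwS t (by omega), ?_⟩
    rw [hu, hq, hw t h ht (by omega), hw t (h + 1) (by omega) (by omega)]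
    omega
  have hwS' : ∀ t, h + 1 ≤ t → t ≤ D → w t ∈ S' := by
    intro t ht htD
    refine ⟨hwS t htD, ?_⟩
    rw [comm, comm _ q, hu, hq, hw h t (by omega) (by omega), hw (h + 1) t (by omega) (by omega)]
    omega
  have hyS' : y ∈ S' := hwD ▸ hwS' D (by omega) le_rfl
  have hqy : G.dist q y = D - (h + 1) := by
    have := hw (h + 1) D (by omega) le_rfl
    rwa [hwD] at this
  -- A deeper vertex of `B` would be farther from `y` than `x` is.
  have hBu : ∀ b ∈ B, G.dist b u ≤ h := by
    intro b hb
    have h1 := hBS b hb y hyS'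
    have h2 := hmax b hb.1 y hy
    omega
  have hBB : ∀ b ∈ B, ∀ c ∈ B, G.dist b c ≤ k := by
    intro b hb c hc
    have h1 := hBu b hb
    have h2 := hBu c hc
    have h3 := tri b u c
    rw [comm u c] at h3
    omega
  -- A geodesic between vertices of `S'` that entered `B` would cross the edge `uq` twice.
  have hconv : G.IsGeodConvex S' := by
    intro a c z ha hc hz
    have hzS := hS ha.1 hc.1 hz
    rw [hunion] at hzS
    rcases hzS with hzS | hzB
    · exact hzS
    · have h1 := hBS z hzB a ha
      have h2 := hBS z hzB c hc
      have h3 := tri a q c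
      rw [comm a z] at hz
      rw [comm a q] at h3
      omega
  have hcardB : h + 1 ≤ B.ncard := by
    have hsub : w '' (Set.Iic h) ⊆ B := by
      rintro _ ⟨t, ht, rfl⟩
      exact hwB t ht
    have h1 := Set.ncard_le_ncard hsub
    rw [Set.InjOn.ncard_image fun s hs t ht hst =>
      hwinj s (by simp only [Set.mem_Iic] at hs; omega) t
        (by simp only [Set.mem_Iic] at ht; omega) hst, Set.ncard_eq_toFinset_card'] at h1
    simpa using h1
  have hcardS' : h + 1 ≤ S'.ncard := by
    have hsub : w '' (Set.Icc (h + 1) (2 * h + 1)) ⊆ S' := by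
      rintro _ ⟨t, ht, rfl⟩
      simp only [Set.mem_Icc] at ht
      exact hwS' t ht.1 (by omega)
    have h1 := Set.ncard_le_ncard hsub
    rw [Set.InjOn.ncard_image fun s hs t ht hst =>
      hwinj s (by simp only [Set.mem_Icc] at hs; omega) t
        (by simp only [Set.mem_Icc] at ht; omega) hst, Set.ncard_eq_toFinset_card'] at h1
    have : (Set.Icc (h + 1) (2 * h + 1)).toFinset.card = h + 1 := by
      simp only [Set.toFinset_Icc, Nat.card_Icc]
      omega
    omega
  obtain ⟨h1, h2⟩ := ncard_maxDistIndepIn_union_branch (k := k) hdisj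
    (fun b => G.dist b u + 1) (fun s => G.dist q s) hBS hBB
  rw [← hunion] at h1 h2
  refine ⟨S', B, hdisj, hunion, hconv, hcardB, hcardS', h1, fun hh hD3 => ?_⟩
  have d0 : G.dist (w 0) u = h := by
    rw [hu, hw 0 h (by omega) (by omega)]
    omega
  have d1 : G.dist (w 1) u = h - 1 := hw 1 h hh (by omega)
  have e1 : G.dist q (w (D - 1)) = D - 1 - (h + 1) := hw (h + 1) (D - 1) (by omega) (by omega)
  have hyz : G.dist (w (D - 1)) y = 1 := by
    have := hw (D - 1) D (by omega) le_rfl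
    rw [hwD] at this
    omega
  -- The first two vertices of the path serve as `b₀`, `b₁` and the last two as the close pair. The
  -- tightest requirement is h + (D - 1 - (h + 1)) ≥ k + 1, that is, D ≥ k + 3.
  refine h2 (w 0) (hwB 0 (by omega)) (w 1) (hwB 1 hh) (fun h01 => ?_) ?_ (w (D - 1))
    (hwS' (D - 1) (by omega) (by omega)) y hyS' (fun hyz' => ?_) (by omega) ?_ ?_
  · have := hwinj 0 (by omega) 1 (by omega) h01
    omega
  · simp only [d0, d1]
    omega
  · rw [hyz', dist_self] at hyz
    omega
  · simp only [d1, e1]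
    omega
  · simp only [d1, hqy]
    omega

lemma ncard_le_ncard_maxDistIndepIn [Finite V] {S : Set V}
    (hS : ∀ u ∈ S, ∀ v ∈ S, G.dist u v ≤ k) : S.ncard ≤ (maxDistIndepIn G k S).ncard := by
  rw [← Set.ncard_image_of_injective S Set.singleton_injective]
  refine Set.ncard_le_ncard ?_
  rintro _ ⟨v, hv, rfl⟩
  rw [mem_maxDistIndepIn_iff]
  exact ⟨Set.singleton_subset_iff.2 hv, IsDistIndep.singleton v, fun u hu _ => ⟨v, rfl, hS u hu v hv⟩⟩

lemma div_succ_add_one_le {a b c : ℕ} (hc : c ≤ b) (hc0 : 0 < c) : a / c + 1 ≤ (a + b) / c := by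
  rw [← Nat.add_div_right a hc0]
  exact Nat.div_le_div_right (by omega)

/-- The lower bound for convex subsets of a tree. -/
lemma SimpleGraph.IsTree.card_lt_ncard_maxDistIndepIn_add [Finite V] (hG : G.IsTree)
    (hk : k = 2 * h) {S : Set V} (hS : G.IsGeodConvex S) (hcard : h + 1 ≤ S.ncard) :
    S.ncard + 1 ≤ (maxDistIndepIn G k S).ncard + S.ncard / (h + 1) := by
  induction hn : S.ncard using Nat.strong_induction_on generalizing S with
  | _ n ih =>
    subst hn
    have hne : (S ×ˢ S).Nonempty := by
      have : S.Nonempty := Set.nonempty_of_ncard_ne_zero (by omega)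
      exact this.prod this
    obtain ⟨⟨x, y⟩, ⟨hx, hy⟩, hmax⟩ :=
      Set.exists_max_image (S ×ˢ S) (fun p => G.dist p.1 p.2) (Set.toFinite _) hne
    have hmax' : ∀ u ∈ S, ∀ v ∈ S, G.dist u v ≤ G.dist x y := fun u hu v hv =>
      hmax (u, v) ⟨hu, hv⟩
    -- A cut loses at most one set against `B.ncard`, and `h + 1 ≤ B.ncard` raises the quotient by
    -- at least one to pay for it. Without a cut, singletons give `S.ncard` sets and the quotient is
    -- at least 1.
    by_cases hD : k + 1 ≤ G.dist x y
    · obtain ⟨S', B, hdisj, rfl, hconv, hB, hS', hM, -⟩ := hG.exists_cut hk hS hx hy hmax' hD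
      rw [Set.ncard_union_eq hdisj] at ih ⊢
      have := ih S'.ncard (by omega) hconv hS' rfl
      have := div_succ_add_one_le (a := S'.ncard) hB (by omega)
      omega
    · have := ncard_le_ncard_maxDistIndepIn (k := k) (G := G) (S := S)
        fun u hu v hv => by have := hmax' u hu v hv; omega
      have : 1 ≤ S.ncard / (h + 1) := (Nat.one_le_div_iff (by omega)).2 hcard
      omega

lemma isGeodConvex_univ : G.IsGeodConvex Set.univ := fun _ _ _ _ _ _ => trivial

/-- The general lower bound on the number of maximal distance-`k` independent sets of a tree. -/
lemma SimpleGraph.IsTree.card_lt_mdi_add [Finite V] (hG : G.IsTree) (hk : k = 2 * h)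
    (hcard : h + 1 ≤ Nat.card V) : Nat.card V + 1 ≤ mdi G k + Nat.card V / (h + 1) := by
  have := hG.card_lt_ncard_maxDistIndepIn_add hk isGeodConvex_univ
    (by rwa [Set.ncard_univ])
  rwa [Set.ncard_univ, ← mdi_eq_ncard_maxDistIndepIn_univ] at this

/-- Trees of diameter at least `k + 3` are not minimal. -/
lemma SimpleGraph.IsTree.card_add_two_le_of_three_le [Finite V] (hG : G.IsTree) (hk : k = 2 * h)
    (hh : 1 ≤ h) {x y : V} (hmax : ∀ u v, G.dist u v ≤ G.dist x y) (hD : k + 3 ≤ G.dist x y) :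
    Nat.card V + 2 ≤ mdi G k + Nat.card V / (h + 1) := by
  obtain ⟨S', B, hdisj, hU, hconv, hB, hS', -, hM⟩ := hG.exists_cut hk isGeodConvex_univ
    (Set.mem_univ x) (Set.mem_univ y) (fun u _ v _ => hmax u v) (by omega)
  have h1 := hG.card_lt_ncard_maxDistIndepIn_add hk hconv hS'
  have h2 := hM hh hD
  have h3 := Set.ncard_union_eq hdisj
  rw [← hU, Set.ncard_univ] at h3
  rw [← mdi_eq_ncard_maxDistIndepIn_univ] at h2
  have := div_succ_add_one_le (a := S'.ncard) hB (by omega)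
  rw [h3]
  omega

/-- Trees with a diametral twin that is far from two vertices close to each other are not
minimal. -/
lemma SimpleGraph.IsTree.card_add_two_le_of_twin [Finite V] (hG : G.IsTree) (hk : k = 2 * h)
    (hcard : h + 2 ≤ Nat.card V) {x w a b : V} (hmax : ∀ u v, G.dist u v ≤ G.dist x w)
    (htw : IsKTwin G k x) (ha : k + 1 ≤ G.dist x a) (hb : k + 1 ≤ G.dist x b) (hab : a ≠ b)
    (habk : G.dist a b ≤ k) : Nat.card V + 2 ≤ mdi G k + Nat.card V / (h + 1) := by
  obtain ⟨y, hyx, hxy⟩ := htw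
  have h1 := ncard_maxDistIndepIn_compl_singleton_of_twin hyx hxy ha hb hab habk
  have h2 := Set.ncard_add_ncard_compl ({x} : Set V)
  rw [Set.ncard_singleton] at h2
  -- Deleting `x` removes one vertex but at least two sets, and it cannot raise the quotient.
  have h3 := hG.card_lt_ncard_maxDistIndepIn_add hk (hG.isGeodConvex_compl_singleton hmax)
    (by omega)
  have h4 : ({x}ᶜ : Set V).ncard / (h + 1) ≤ Nat.card V / (h + 1) :=
    Nat.div_le_div_right (by omega)
  omega

lemma mdi_eq_card [Finite V] [Nonempty V] (hk : ∀ u v, G.dist u v ≤ k) :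
    mdi G k = Nat.card V := by
  have h := mdi_eq_of_isDistIndep_of_forall_dist_le (G := G) (k := k) (L := ∅)
    (fun _ _ h => h.elim) (fun u v _ _ => hk u v)
  have hempty : ({J | J = ∅ ∧ J ∈ maxDistIndepIn G k Set.univ} : Set (Set V)) = ∅ := by
    ext J
    simp only [Set.mem_ofPred_eq, Set.mem_empty_iff_false, iff_false]
    rintro ⟨rfl, hJ⟩
    obtain ⟨u, hu, -⟩ := (mem_maxDistIndepIn_iff.1 hJ).2.2 (Classical.arbitrary V) trivial id
    exact hu
  rw [h, hempty]
  simp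

/-- The count when `L` is extendable. -/
lemma mdi_add_ncard_of_far_vertex [Finite V] {L : Set V} (hL : IsDistIndep G k L)
    (hLc : ∀ u v, u ∉ L → v ∉ L → G.dist u v ≤ k) {v : V} (hvL : v ∉ L)
    (hv : ∀ l ∈ L, k + 1 ≤ G.dist v l) : mdi G k + L.ncard = Nat.card V := by
  have h := mdi_eq_of_isDistIndep_of_forall_dist_le hL hLc
  have hempty : ({J | J = L ∧ J ∈ maxDistIndepIn G k Set.univ} : Set (Set V)) = ∅ := by
    ext J
    simp only [Set.mem_ofPred_eq, Set.mem_empty_iff_false, iff_false]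
    rintro ⟨rfl, hJ⟩
    obtain ⟨u, hu, hvu⟩ := (mem_maxDistIndepIn_iff.1 hJ).2.2 v trivial hvL
    have := hv u hu
    omega
  rw [h, hempty, Set.ncard_empty, ← Set.ncard_add_ncard_compl L]
  omega

/-- The count when `L` is not extendable. -/
lemma mdi_add_ncard_of_forall_near [Finite V] {L : Set V} (hL : IsDistIndep G k L)
    (hLc : ∀ u v, u ∉ L → v ∉ L → G.dist u v ≤ k)
    (hnear : ∀ v ∉ L, ∃ l ∈ L, G.dist v l ≤ k) : mdi G k + L.ncard = Nat.card V + 1 := by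
  have h := mdi_eq_of_isDistIndep_of_forall_dist_le hL hLc
  have hone : ({J | J = L ∧ J ∈ maxDistIndepIn G k Set.univ} : Set (Set V)) = {L} := by
    ext J
    simp only [Set.mem_ofPred_eq, Set.mem_singleton_iff, and_iff_left_iff_imp]
    rintro rfl
    rw [mem_maxDistIndepIn_iff]
    exact ⟨Set.subset_univ _, hL, fun v _ hv => hnear v hv⟩
  rw [h, hone, Set.ncard_singleton, ← Set.ncard_add_ncard_compl L]
  omega

/-- Endpoints of long paths that are close to each other are twins. -/
lemma SimpleGraph.IsTree.closedNbhd_subset (hG : G.IsTree) {m : ℕ} (hmax : ∀ u v, G.dist u v ≤ m)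
    {x y w : V} (hxw : G.dist x w = m) (hxy : G.dist x y ≤ k) :
    closedNbhd G k x ⊆ closedNbhd G k y := by
  intro z hz
  have hz' : G.dist x z ≤ k := hz
  change G.dist y z ≤ k
  -- Since `w` is at maximum distance from `x`, this yields d(y, z) ≤ max (d(x, y), d(x, z)) ≤ k.
  have h1 := hG.four_point x w y z
  have h2 := hmax w z
  have h3 := hmax w y
  omega

lemma SimpleGraph.IsTree.closedNbhd_eq (hG : G.IsTree) {m : ℕ} (hmax : ∀ u v, G.dist u v ≤ m)
    {x y w z : V} (hxw : G.dist x w = m) (hyz : G.dist y z = m) (hxy : G.dist x y ≤ k) :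
    closedNbhd G k x = closedNbhd G k y :=
  (hG.closedNbhd_subset hmax hxw hxy).antisymm
    (hG.closedNbhd_subset hmax hyz (by rwa [G.dist_comm]))

/-- Trees of diameter `k + 1` having an endpoint of a longest path that is not a twin. -/
lemma SimpleGraph.IsTree.mdi_of_diam_eq_add_one [Finite V] (hG : G.IsTree) (hk : k = 2 * h)
    (hmax : ∀ u v, G.dist u v ≤ k + 1) {x y : V} (hxy : G.dist x y = k + 1)
    (hx : ¬ IsKTwin G k x) : mdi G k + 1 = Nat.card V := by
  have comm := fun a b => G.dist_comm (u := a) (v := b)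
  -- Evenness of `k` enters here: `x`, `u`, `v` cannot be pairwise at the odd distance k + 1, as the
  -- perimeter is even. So `v` would be close to `x`, hence a twin of it.
  have key : ∀ u v, u ≠ x → v ≠ x → G.dist u v = k + 1 → G.dist x u ≠ k + 1 := by
    intro u v hu hv huv hxu
    have hp := hG.even_perimeter x u v
    have hxv : G.dist x v ≤ k := by
      by_contra hcon
      have := hmax x v
      obtain ⟨c, hc⟩ := hp
      omega
    exact hx ⟨v, hv, hG.closedNbhd_eq hmax hxy (by rw [comm v u]; exact huv) hxv⟩
  have h1 := mdi_add_ncard_of_far_vertex (G := G) (k := k) (L := {x}) (v := y)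
    (IsDistIndep.singleton x) (fun u v hu hv => ?_) ?_ ?_
  · rwa [Set.ncard_singleton] at h1
  · by_contra hcon
    have huv : G.dist u v = k + 1 := by have := hmax u v; omega
    -- By `key`, each sum on the right is at most k + (k + 1), less than the 2(k + 1) on the left.
    have h4 := hG.four_point x y u v
    have := key u v hu hv huv
    have := key v u hv hu (by rw [comm]; exact huv)
    have := hmax x u
    have := hmax x v
    have := hmax y u
    have := hmax y v
    omega
  · rintro rfl
    rw [dist_self] at hxy
    omega
  · rintro l rfl
    rw [comm]
    omega

/-- Two ends of longest paths within distance `k` of each other would be twins. -/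
lemma SimpleGraph.IsTree.isDistIndep_ends (hG : G.IsTree) (hmax : ∀ u v, G.dist u v ≤ k + 2)
    (htw : ∀ u v, G.dist u v = k + 2 → ¬ IsKTwin G k u) :
    IsDistIndep G k {v | ∃ w, G.dist v w = k + 2} := by
  rintro u v ⟨w, hw⟩ ⟨z, hz⟩ huv
  by_contra hcon
  exact htw u w hw ⟨v, huv.symm, hG.closedNbhd_eq hmax hw hz (by omega)⟩

/-- Non-ends are within k + 1 of both `x` and `y`, so the four-point condition gives (k + 2) + d(u,
v) ≤ 2(k + 1). -/
lemma SimpleGraph.IsTree.dist_le_of_not_ends (hG : G.IsTree)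
    (hmax : ∀ u v, G.dist u v ≤ k + 2) {x y : V} (hxy : G.dist x y = k + 2) (u v : V)
    (hu : u ∉ {v | ∃ w, G.dist v w = k + 2})
    (hv : v ∉ {v | ∃ w, G.dist v w = k + 2}) : G.dist u v ≤ k := by
  have comm := fun a b => G.dist_comm (u := a) (v := b)
  have hu' : ∀ w, G.dist u w ≤ k + 1 := fun w => by
    have : G.dist u w ≠ k + 2 := fun h => hu ⟨w, h⟩
    have := hmax u w
    omega
  have hv' : ∀ w, G.dist v w ≤ k + 1 := fun w => by
    have : G.dist v w ≠ k + 2 := fun h => hv ⟨w, h⟩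
    have := hmax v w
    omega
  have h4 := hG.four_point x y u v
  have h1 := hu' x
  have h2 := hu' y
  have h3 := hv' x
  have h5 := hv' y
  rw [comm _ x] at h1 h3
  rw [comm _ y] at h2 h5
  omega

end TreeBounds

/-! ### Diametral leaves -/

section Leaves

open SimpleGraph

variable {V : Type*} {G : SimpleGraph V}

lemma SimpleGraph.Connected.dist_le_diam_of_finite [Finite V] (hG : G.Connected) (u v : V) :
    G.dist u v ≤ G.diam := by
  have := hG.nonempty
  exact dist_le_diam (connected_iff_ediam_ne_top.1 hG)

/-- An end of a longest path in a tree is a leaf. -/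
lemma SimpleGraph.IsTree.isLeafVertex_of_dist_max (hG : G.IsTree) {x w : V}
    (hmax : ∀ u v, G.dist u v ≤ G.dist x w) (hpos : 0 < G.dist x w) : IsLeafVertex G x := by
  obtain ⟨a, ha, -⟩ := hG.connected.exists_dist_eq x w (t := 1) hpos
  refine Set.ncard_eq_one.2 ⟨a, ?_⟩
  ext b
  simp only [mem_neighborSet, Set.mem_singleton_iff]
  refine ⟨fun hb => ?_, fun hb => by rw [hb]; exact dist_eq_one_iff_adj.1 ha⟩
  by_contra hba
  have hb1 : G.dist x b = 1 := dist_eq_one_iff_adj.2 hb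
  -- By parity two neighbours of `x` are at distance exactly 2, so `x` lies between them, against
  -- convexity of its complement.
  have h1 := hG.even_perimeter a x b
  have h2 := hG.connected.dist_triangle (u := a) (v := x) (w := b)
  have h3 := hG.connected.pos_dist_of_ne (Ne.symm hba)
  rw [G.dist_comm (u := a) (v := x)] at h1 h2
  have hab : G.dist a x + G.dist x b = G.dist a b := by
    rw [G.dist_comm (u := a) (v := x)]
    obtain ⟨c, hc⟩ := h1
    omega
  refine hG.isGeodConvex_compl_singleton hmax ?_ ?_ hab rfl
  · rintro rfl
    simp at ha
  · rintro rfl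
    simp at hb1

/-- Diametral leaves of a tree are the ends of the longest paths. -/
lemma SimpleGraph.IsTree.isDiametralLeaf_iff [Finite V] [Nontrivial V] (hG : G.IsTree) (v : V) :
    IsDiametralLeaf G v ↔ ∃ w, G.dist v w = G.diam := by
  have hle := hG.connected.dist_le_diam_of_finite
  have hcoe : ∀ u v, G.edist u v = G.dist u v := fun u v => (hG.connected u v).coe_dist_eq_edist.symm
  have hpos : 0 < G.diam := Nat.pos_of_ne_zero (connected_iff_diam_ne_zero.1 hG.connected)
  have hleaf : ∀ x w, G.dist x w = G.diam → IsLeafVertex G x := fun x w hxw =>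
    hG.isLeafVertex_of_dist_max (w := w) (fun u v => hxw ▸ hle u v) (hxw ▸ hpos)
  constructor
  · rintro ⟨-, h⟩
    obtain ⟨x, y, hxy⟩ := G.exists_dist_eq_diam
    have h1 := h x (hleaf x y hxy)
    obtain ⟨w, hw⟩ := G.exists_edist_eq_eccent_of_finite v
    have h2 : G.edist x y ≤ G.eccent x := edist_le_eccent
    rw [← hw, hcoe] at h1
    rw [hcoe, hxy] at h2
    have h3 : G.diam ≤ G.dist v w := by exact_mod_cast h2.trans h1
    exact ⟨w, (hle v w).antisymm h3⟩
  · rintro ⟨w, hw⟩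
    refine ⟨hleaf v w hw, fun u _ => ?_⟩
    have h1 : G.edist v w ≤ G.eccent v := edist_le_eccent
    rw [hcoe, hw] at h1
    refine le_trans ((eccent_le_iff u _).2 fun z => ?_) h1
    rw [hcoe]
    exact_mod_cast hle u z

end Leaves

/-! ### Copies, paths and isomorphisms -/

section Copies

open SimpleGraph

variable {V W : Type*} {G : SimpleGraph V} {H : SimpleGraph W}

/-- A function changing by at most one along edges bounds distances from below. -/
lemma SimpleGraph.Connected.sub_le_dist (hG : G.Connected) (f : V → ℤ)
    (hf : ∀ u v, G.Adj u v → f u - f v ≤ 1) (u v : V) : f u - f v ≤ G.dist u v := by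
  obtain ⟨p, hp⟩ := hG.exists_walk_length_eq_dist u v
  rw [← hp]
  clear hp
  induction p with
  | nil => simp
  | cons h p ih =>
    have := hf _ _ h
    rw [Walk.length_cons]
    push_cast
    omega

/-- Copies of connected graphs in trees preserve distances. -/
lemma SimpleGraph.IsTree.dist_copy (hG : G.IsTree) (hH : H.Connected) (f : Copy H G) (a b : W) :
    G.dist (f a) (f b) = H.dist a b := by
  obtain ⟨p, hp, hpl⟩ := hH.exists_path_of_dist a b
  have h1 : (p.map f.toHom).IsPath := hp.map f.injective
  obtain ⟨q, hq, hql⟩ := hG.connected.exists_path_of_dist (f a) (f b)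
  have h2 := (hG.existsUnique_path _ _).unique hq h1
  rw [← hql, ← hpl, h2, Walk.length_map]

lemma SimpleGraph.Connected.diam_eq [Finite V] (hG : G.Connected) {m : ℕ}
    (hle : ∀ u v, G.dist u v ≤ m) {x y : V} (hxy : m ≤ G.dist x y) : G.diam = m := by
  have := hG.nonempty
  obtain ⟨a, b, hab⟩ := G.exists_dist_eq_diam
  have := hle a b
  have := hG.dist_le_diam_of_finite x y
  omega

lemma diam_pathGraph (m : ℕ) : (pathGraph (m + 1)).diam = m := by
  have hconn := pathGraph_connected m
  have hlow := hconn.sub_le_dist (fun i => (i.val : ℤ)) (fun u v huv => by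
    rw [pathGraph_adj] at huv
    omega)
  have hupp : ∀ d : ℕ, ∀ i j : Fin (m + 1), (i : ℕ) + d = j → (pathGraph (m + 1)).dist i j ≤ d := by
    intro d
    induction d with
    | zero =>
      intro i j hij
      rw [show i = j from Fin.ext (by omega), dist_self]
    | succ d ih =>
      intro i j hij
      have h1 := ih i ⟨i + d, by omega⟩ rfl
      have h2 : (pathGraph (m + 1)).dist ⟨i + d, by omega⟩ j = 1 := by
        rw [dist_eq_one_iff_adj, pathGraph_adj]
        simp only
        omega
      have := hconn.dist_triangle (u := i) (v := ⟨i + d, by omega⟩) (w := j)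
      omega
  refine hconn.diam_eq (fun u v => ?_) (x := Fin.last m) (y := 0) ?_
  · rcases le_total u v with h | h
    · exact (hupp (v - u) u v (by omega)).trans (by omega)
    · rw [dist_comm]
      exact (hupp (u - v) v u (by omega)).trans (by omega)
  · have := hlow (Fin.last m) 0
    simp at this
    exact this

lemma SimpleGraph.Connected.pathGraph_isContained (hG : G.Connected) (x y : V) :
    (pathGraph (G.dist x y + 1)).IsContained G := by
  obtain ⟨w, -, -, hw⟩ := hG.exists_dist_walk x y
  refine ⟨⟨⟨fun i => w i, fun {a b} hab => ?_⟩, fun a b hab => ?_⟩⟩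
  · rw [pathGraph_adj] at hab
    rw [← dist_eq_one_iff_adj]
    rcases hab with h | h
    · rw [hw a b (by omega) (by omega)]
      omega
    · rw [dist_comm, hw b a (by omega) (by omega)]
      omega
  · change w a = w b at hab
    rcases le_total a b with h | h
    · have := hw a b h (by omega)
      rw [hab, dist_self] at this
      exact Fin.ext (by omega)
    · have := hw b a h (by omega)
      rw [hab, dist_self] at this
      exact Fin.ext (by omega)

lemma SimpleGraph.Connected.nonempty_iso_pathGraph [Finite V] (hG : G.Connected) {x y : V} {m : ℕ}
    (hxy : G.dist x y = m) (hcard : Nat.card V = m + 1) : Nonempty (G ≃g pathGraph (m + 1)) := by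
  subst hxy
  obtain ⟨w, -, -, hw⟩ := hG.exists_dist_walk x y
  have hd : ∀ a b : Fin (G.dist x y + 1), a ≤ b → G.dist (w a) (w b) = b - a := fun a b hab =>
    hw a b hab (by omega)
  have hinj : Function.Injective fun i : Fin (G.dist x y + 1) => w i := by
    intro a b hab
    change w a = w b at hab
    rcases le_total a b with h | h
    · have := hd a b h
      rw [hab, dist_self] at this
      exact Fin.ext (by omega)
    · have := hd b a h
      rw [hab, dist_self] at this
      exact Fin.ext (by omega)
  have hbij : Function.Bijective fun i : Fin (G.dist x y + 1) => w i :=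
    (Nat.bijective_iff_injective_and_card _).2 ⟨hinj, by simp [hcard]⟩
  refine ⟨RelIso.symm ⟨Equiv.ofBijective _ hbij, fun {a b} => ?_⟩⟩
  change G.Adj (w a) (w b) ↔ _
  rw [← dist_eq_one_iff_adj, pathGraph_adj]
  rcases le_total a b with h | h
  · rw [hd a b h]
    omega
  · rw [dist_comm, hd b a h]
    omega

lemma SimpleGraph.Connected.dist_lt_card [Finite V] (hG : G.Connected) (x y : V) :
    G.dist x y < Nat.card V := by
  obtain ⟨f⟩ := hG.pathGraph_isContained x y
  have := Nat.card_le_card_of_injective _ f.injective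
  rw [Nat.card_fin] at this
  omega

lemma SimpleGraph.Hom.edist_le (f : G →g H) (u v : V) : H.edist (f u) (f v) ≤ G.edist u v := by
  refine le_iInf fun p => ?_
  rw [← Walk.length_map f p]
  exact SimpleGraph.edist_le _

lemma SimpleGraph.Iso.dist_eq (e : G ≃g H) (u v : V) : H.dist (e u) (e v) = G.dist u v := by
  rw [dist, dist]
  congr 1
  apply le_antisymm (Hom.edist_le e.toHom u v)
  simpa using Hom.edist_le e.symm.toHom (e u) (e v)

lemma mdi_congr (e : G ≃g H) (k : ℕ) : mdi G k = mdi H k := by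
  have hind : ∀ J, IsDistIndep H k (e '' J) ↔ IsDistIndep G k J := by
    intro J
    constructor
    · intro hJ u v hu hv huv
      rw [← e.dist_eq]
      exact hJ ⟨u, hu, rfl⟩ ⟨v, hv, rfl⟩ (e.injective.ne huv)
    · rintro hJ _ _ ⟨u, hu, rfl⟩ ⟨v, hv, rfl⟩ huv
      rw [e.dist_eq]
      exact hJ hu hv (fun h => huv (h ▸ rfl))
  have hsurj : ∀ K : Set W, ∃ J : Set V, e '' J = K := fun K =>
    ⟨e ⁻¹' K, Set.image_preimage_eq K e.surjective⟩
  have hmax : ∀ J, IsMaxDistIndep H k (e '' J) ↔ IsMaxDistIndep G k J := by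
    intro J
    constructor
    · rintro ⟨h1, h2⟩
      refine ⟨(hind J).1 h1, fun K hK hJK => ?_⟩
      exact (Set.image_subset_image_iff e.injective).1
        (h2 ((hind K).2 hK) (Set.image_mono hJK))
    · rintro ⟨h1, h2⟩
      refine ⟨(hind J).2 h1, fun K hK hJK => ?_⟩
      obtain ⟨K, rfl⟩ := hsurj K
      exact Set.image_mono (h2 ((hind K).1 hK) ((Set.image_subset_image_iff e.injective).1 hJK))
  rw [mdi, mdi, ← Set.ncard_image_of_injective _ e.injective.image_injective]
  congr 1
  ext K
  constructor
  · rintro ⟨J, hJ, rfl⟩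
    exact (hmax J).2 hJ
  · intro hK
    obtain ⟨J, rfl⟩ := hsurj K
    exact ⟨J, (hmax J).1 hK, rfl⟩

/-- A connected graph all of whose edges join a non-root vertex to its parent is a tree. -/
lemma SimpleGraph.Connected.isTree_of_parent [Finite V] (hG : G.Connected) (c : V) (par : V → V)
    (hpar : ∀ u v, G.Adj u v → (u ≠ c ∧ v = par u) ∨ (v ≠ c ∧ u = par v)) : G.IsTree := by
  rw [isTree_iff_connected_and_card]
  refine ⟨hG, le_antisymm ?_ hG.card_vert_le_card_edgeSet_add_one⟩
  -- Every edge comes from its child endpoint, so there are at most `Nat.card V - 1` edges.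
  have hsub : G.edgeSet ⊆ (fun v => s(v, par v)) '' {c}ᶜ := by
    intro e
    induction e with
    | _ u v =>
      intro h
      rcases hpar u v h with ⟨h1, rfl⟩ | ⟨h1, rfl⟩
      · exact ⟨u, h1, rfl⟩
      · exact ⟨v, h1, Sym2.eq_swap⟩
  have h1 := (Set.ncard_le_ncard hsub).trans (Set.ncard_image_le (Set.toFinite _))
  have h2 := Set.ncard_add_ncard_compl ({c} : Set V)
  rw [Set.ncard_singleton] at h2
  rw [Nat.card_coe_set_eq]
  omega

end Copies

/-! ### Metric structure of subtrees of spiders -/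

section Spider

open SimpleGraph

variable {P m : ℕ}

lemma spider_adj_none_some {i : Fin P} {j : Fin m} :
    (spider P m).Adj none (some (i, j)) ↔ (j : ℕ) = 0 := by
  simp [spider]

lemma spider_adj_some_some {i i' : Fin P} {j j' : Fin m} :
    (spider P m).Adj (some (i, j)) (some (i', j')) ↔
      i = i' ∧ ((j : ℕ) + 1 = j' ∨ (j' : ℕ) + 1 = j) := by
  simp only [spider, fromRel_adj, ne_eq, Option.some.injEq, Prod.mk.injEq, not_and]
  constructor
  · rintro ⟨-, ⟨h1, h2⟩ | ⟨h1, h2⟩⟩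
    · exact ⟨h1, Or.inl h2⟩
    · exact ⟨h1.symm, Or.inr h2⟩
  · rintro ⟨rfl, h | h⟩
    · exact ⟨fun _ h' => by rw [h'] at h; omega, Or.inl ⟨rfl, h⟩⟩
    · exact ⟨fun _ h' => by rw [h'] at h; omega, Or.inr ⟨rfl, h⟩⟩

/-- The distance of a spider vertex from the centre. -/
def spiderDepth : Option (Fin P × Fin m) → ℕ
  | none => 0
  | some (_, j) => j + 1

variable {W : Type*} {φ : W → Option (Fin P × Fin m)} {c : W}

/-- Stated for any part of a spider containing the centre and closed under moving inwards along
legs; this covers both S' and the extremal tree with pendant vertices. -/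
lemma exists_walk_spider_comap (hφ : Function.Injective φ) (hc : φ c = none)
    (hdown : ∀ w i (j j' : Fin m), φ w = some (i, j) → (j' : ℕ) + 1 = j → ∃ w', φ w' = some (i, j')) (w : W) :
    ∃ p : ((spider P m).comap φ).Walk c w, p.length = spiderDepth (φ w) := by
  induction hd : spiderDepth (φ w) generalizing w with
  | zero =>
    have : w = c := by
      apply hφ
      rw [hc]
      rcases h : φ w with _ | ⟨i, j⟩
      · rfl
      · simp [h, spiderDepth] at hd
    subst this
    exact ⟨Walk.nil, rfl⟩
  | succ d ih =>
    rcases h : φ w with _ | ⟨i, j⟩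
    · simp [h, spiderDepth] at hd
    · simp only [h, spiderDepth, Nat.add_right_cancel_iff] at hd
      rcases d with _ | d
      · have hadj : ((spider P m).comap φ).Adj c w := by
          rw [comap_adj, hc, h, spider_adj_none_some, hd]
        exact ⟨Walk.cons hadj Walk.nil, by simp⟩
      · obtain ⟨w', hw'⟩ := hdown w i j ⟨d, by omega⟩ h (by simp [hd])
        obtain ⟨p, hp⟩ := ih w' (by simp [hw', spiderDepth])
        have hadj : ((spider P m).comap φ).Adj w' w := by
          rw [comap_adj, hw', h, spider_adj_some_some]
          exact ⟨rfl, Or.inl (by simp [hd])⟩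
        exact ⟨p.concat hadj, by simp [hp]⟩

lemma connected_spider_comap (hφ : Function.Injective φ) (hc : φ c = none)
    (hdown : ∀ w i (j j' : Fin m), φ w = some (i, j) → (j' : ℕ) + 1 = j → ∃ w', φ w' = some (i, j')) :
    ((spider P m).comap φ).Connected := by
  rw [connected_iff_exists_forall_reachable]
  exact ⟨c, fun w => ⟨(exists_walk_spider_comap hφ hc hdown w).choose⟩⟩

/-- Adjacent vertices have different depths, and a vertex has at most one neighbour of smaller
depth, its parent. -/
lemma isTree_spider_comap [Finite W] (hφ : Function.Injective φ) (hc : φ c = none)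
    (hdown : ∀ w i (j j' : Fin m), φ w = some (i, j) → (j' : ℕ) + 1 = j → ∃ w', φ w' = some (i, j')) :
    ((spider P m).comap φ).IsTree := by
  classical
  have hpar : ∀ u, ∃ p : W, ∀ v, ((spider P m).comap φ).Adj v u →
      spiderDepth (φ v) < spiderDepth (φ u) → v = p := by
    intro u
    by_cases h : ∃ p, ((spider P m).comap φ).Adj p u ∧ spiderDepth (φ p) < spiderDepth (φ u)
    · obtain ⟨p, hp, hpd⟩ := h
      refine ⟨p, fun v hv hvd => hφ ?_⟩
      rw [comap_adj] at hp hv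
      revert hp hv hpd hvd
      generalize φ u = a
      generalize φ v = b
      generalize φ p = d
      rcases a with _ | ⟨i, j⟩
      · simp [spiderDepth]
      rcases b with _ | ⟨i', j'⟩ <;> rcases d with _ | ⟨i'', j''⟩ <;>
        simp only [spider_adj_none_some, spider_adj_some_some, spiderDepth] <;> intros
      · trivial
      · omega
      · omega
      · simp only [Option.some.injEq, Prod.mk.injEq, Fin.ext_iff]
        grind
    · push Not at h
      exact ⟨u, fun v hv hvd => absurd hvd (not_lt.2 (h v hv))⟩
  choose par hpar using hpar
  have hdepth : ∀ u v, ((spider P m).comap φ).Adj u v →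
      spiderDepth (φ u) ≠ spiderDepth (φ v) := by
    intro u v huv
    rw [comap_adj] at huv
    revert huv
    generalize φ u = a
    generalize φ v = b
    rcases a with _ | ⟨i, j⟩ <;> rcases b with _ | ⟨i', j'⟩
    · simp
    · simp [spiderDepth]
    · simp [spiderDepth]
    · rw [spider_adj_some_some]
      simp only [spiderDepth]
      omega
  have hc0 : spiderDepth (φ c) = 0 := by rw [hc]; rfl
  refine (connected_spider_comap hφ hc hdown).isTree_of_parent c par fun u v huv => ?_
  rcases (hdepth u v huv).lt_or_gt with h | h
  · exact Or.inr ⟨fun hv => by rw [hv, hc0] at h; omega, hpar v u huv h⟩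
  · exact Or.inl ⟨fun hv => by rw [hv, hc0] at h; omega, hpar u v huv.symm h⟩

lemma dist_spider_comap_le (hφ : Function.Injective φ) (hc : φ c = none)
    (hdown : ∀ w i (j j' : Fin m), φ w = some (i, j) → (j' : ℕ) + 1 = j → ∃ w', φ w' = some (i, j')) (u v : W) :
    ((spider P m).comap φ).dist u v ≤ spiderDepth (φ u) + spiderDepth (φ v) := by
  obtain ⟨p, hp⟩ := exists_walk_spider_comap hφ hc hdown u
  obtain ⟨q, hq⟩ := exists_walk_spider_comap hφ hc hdown v
  have := dist_le (p.reverse.append q)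
  simpa [hp, hq] using this

/-- The depth, taken positive on leg `i` and negative on the other legs, changes by at most one
along each edge. -/
lemma le_dist_spider_comap (hφ : Function.Injective φ) (hc : φ c = none)
    (hdown : ∀ w i (j j' : Fin m), φ w = some (i, j) → (j' : ℕ) + 1 = j → ∃ w', φ w' = some (i, j'))
    {u v : W} {i i' : Fin P} {j j' : Fin m} (hu : φ u = some (i, j)) (hv : φ v = some (i', j'))
    (hii : i ≠ i') : (j : ℕ) + 1 + (j' + 1) ≤ ((spider P m).comap φ).dist u v := by
  set g : Option (Fin P × Fin m) → ℤ := fun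
    | none => 0
    | some (l, t) => if l = i then (t : ℤ) + 1 else - ((t : ℤ) + 1) with hg
  have := (connected_spider_comap hφ hc hdown).sub_le_dist (fun w => g (φ w)) (fun a b hab => by
    rw [comap_adj] at hab
    revert hab
    generalize φ a = a
    generalize φ b = b
    rcases a with _ | ⟨l, t⟩ <;> rcases b with _ | ⟨l', t'⟩
    · simp
    · rw [spider_adj_none_some]
      simp only [hg]
      split_ifs <;> omega
    · rw [adj_comm, spider_adj_none_some]
      simp only [hg]
      split_ifs <;> omega
    · rw [spider_adj_some_some]
      rintro ⟨rfl, h⟩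
      simp only [hg]
      split_ifs <;> omega) u v
  simp only [hu, hv, hg, if_pos, if_neg hii.symm] at this
  omega

end Spider

/-! ### The spider with one shortened leg -/

section SpiderMinus

open SimpleGraph

variable {p m : ℕ}

/-- The centre of the spider. -/
def SpiderMinusVertex.center (p m : ℕ) : SpiderMinusVertex p m := ⟨none, by simp⟩

lemma spiderMinus_down (w : SpiderMinusVertex p m) (i : Fin p) (j j' : Fin m)
    (_ : w.val = some (i, j)) (hj : (j' : ℕ) + 1 = j) :
    ∃ w' : SpiderMinusVertex p m, w'.val = some (i, j') := by
  refine ⟨⟨some (i, j'), ?_⟩, rfl⟩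
  intro a b hab
  simp only [Option.some.injEq, Prod.mk.injEq] at hab
  obtain ⟨rfl, rfl⟩ := hab
  omega

lemma connected_spiderMinus : (spiderMinus p m).Connected :=
  connected_spider_comap (c := SpiderMinusVertex.center p m) Subtype.val_injective rfl spiderMinus_down

lemma card_spiderMinusVertex (hp : 1 ≤ p) (hm : 1 ≤ m) :
    Nat.card (SpiderMinusVertex p m) = p * m := by
  have h : ∀ v : Option (Fin p × Fin m),
      (∀ i j, v = some (i, j) → ¬ ((i : ℕ) + 1 = p ∧ (j : ℕ) + 1 = m)) ↔
        v ∈ ({some (⟨p - 1, by omega⟩, ⟨m - 1, by omega⟩)}ᶜ : Set (Option (Fin p × Fin m))) := by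
    intro v
    simp only [Set.mem_compl_iff, Set.mem_singleton_iff]
    constructor
    · rintro h rfl
      exact h _ _ rfl ⟨by simp; omega, by simp; omega⟩
    · rintro h i j rfl ⟨h1, h2⟩
      exact h (by simp only [Option.some.injEq, Prod.mk.injEq, Fin.ext_iff]; omega)
  have h2 := Set.ncard_add_ncard_compl
    ({some (⟨p - 1, by omega⟩, ⟨m - 1, by omega⟩)} : Set (Option (Fin p × Fin m)))
  rw [Set.ncard_singleton] at h2
  rw [SpiderMinusVertex, Nat.card_congr (Equiv.subtypeEquivRight h)]
  change Set.ncard _ = _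
  rw [show Nat.card (Option (Fin p × Fin m)) = p * m + 1 by simp] at h2
  omega

/-- A vertex of the spider with one shortened leg. -/
def SpiderMinusVertex.mk (i : Fin p) (j : Fin m) (h : ¬ ((i : ℕ) + 1 = p ∧ (j : ℕ) + 1 = m)) :
    SpiderMinusVertex p m :=
  ⟨some (i, j), fun a b hab => by
    simp only [Option.some.injEq, Prod.mk.injEq] at hab
    obtain ⟨rfl, rfl⟩ := hab
    exact h⟩

lemma le_dist_spiderMinus {i i' : Fin p} {j j' : Fin m} {h h'} (hii : i ≠ i') :
    (j : ℕ) + 1 + (j' + 1) ≤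
      (spiderMinus p m).dist (SpiderMinusVertex.mk i j h) (SpiderMinusVertex.mk i' j' h') :=
  le_dist_spider_comap (c := SpiderMinusVertex.center p m) Subtype.val_injective rfl spiderMinus_down rfl rfl hii

lemma spiderDepth_le (v : Option (Fin p × Fin m)) : spiderDepth v ≤ m := by
  rcases v with _ | ⟨i, j⟩
  · exact Nat.zero_le _
  · exact j.isLt

lemma diam_spiderMinus (hp : 3 ≤ p) (hm : 1 ≤ m) : (spiderMinus p m).diam = 2 * m := by
  have h1 := le_dist_spiderMinus (p := p) (m := m) (i := ⟨0, by omega⟩) (i' := ⟨1, by omega⟩)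
    (j := ⟨m - 1, by omega⟩) (j' := ⟨m - 1, by omega⟩) (h := by simp; omega) (h' := by simp; omega)
    (by simp)
  refine connected_spiderMinus.diam_eq (fun u v => ?_) (le_trans (by simp only; omega) h1)
  have := dist_spider_comap_le (c := SpiderMinusVertex.center p m) Subtype.val_injective rfl spiderMinus_down u v
  have h2 := spiderDepth_le u.val
  have h3 := spiderDepth_le v.val
  exact this.trans (by omega)

/-- A tree contains a spider with one shortened leg as soon as there are vertices far from each
other around a suitable centre. -/
lemma SimpleGraph.IsTree.spiderMinus_isContained {V : Type*} {G : SimpleGraph V} (hG : G.IsTree)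
    (c : V) (z : Fin p → V) (hle : ∀ i, G.dist c (z i) ≤ m)
    (hge : ∀ i : Fin p, (i : ℕ) + 1 < p → m ≤ G.dist c (z i)) (hge' : ∀ i, m ≤ G.dist c (z i) + 1)
    (hz : ∀ i j, i ≠ j → 2 * m ≤ G.dist (z i) (z j) + 1) :
    (spiderMinus p m).IsContained G := by
  choose w hw0 hwD hw using fun i => hG.connected.exists_dist_walk c (z i)
  set F : Option (Fin p × Fin m) → V := fun
    | none => c
    | some (i, j) => w i (j + 1) with hF
  -- The deleted leaf is precisely the position that a last leg of length m - 1 could not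
  -- accommodate.
  have hval : ∀ v : SpiderMinusVertex p m, ∀ i j, v.val = some (i, j) →
      (j : ℕ) + 1 ≤ G.dist c (z i) := by
    intro v i j hv
    have h1 := v.2 i j hv
    have h2 := hge i
    have h3 := hge' i
    have := i.isLt
    have := j.isLt
    omega
  have hc : ∀ i t, t ≤ G.dist c (z i) → G.dist c (w i t) = t := by
    intro i t ht
    have := hw i 0 t (by omega) ht
    rwa [hw0] at this
  have hend : ∀ i t, t ≤ G.dist c (z i) → G.dist (w i t) (z i) = G.dist c (z i) - t := by
    intro i t ht
    have := hw i t _ ht le_rfl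
    rwa [hwD] at this
  have hstep : ∀ i t, t + 1 ≤ G.dist c (z i) → G.Adj (w i t) (w i (t + 1)) := by
    intro i t ht
    rw [← dist_eq_one_iff_adj, hw i t (t + 1) (by omega) ht]
    omega
  refine ⟨⟨⟨fun v => F v.val, fun {a b} hab => ?_⟩, fun a b hab => ?_⟩⟩
  · have ha := hval a
    have hb := hval b
    rw [spiderMinus, comap_adj] at hab
    revert ha hb hab
    generalize a.val = a
    generalize b.val = b
    intro hab ha hb
    revert hab
    rcases a with _ | ⟨i, j⟩ <;> rcases b with _ | ⟨i', j'⟩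
    · simp
    · rw [spider_adj_none_some]
      intro h
      have h1 := hstep i' j' (hb i' j' rfl)
      rw [h, hw0] at h1
      simpa [hF, h] using h1
    · rw [adj_comm, spider_adj_none_some]
      intro h
      have h1 := hstep i j (ha i j rfl)
      rw [h, hw0] at h1
      simpa [hF, h] using h1.symm
    · rw [spider_adj_some_some]
      rintro ⟨rfl, h | h⟩
      · have := hstep i (j + 1) (by have := hb i j' rfl; omega)
        simp only [hF, ← h]
        exact this
      · have := hstep i (j' + 1) (by have := ha i j rfl; omega)
        simp only [hF, ← h]
        exact this.symm
  · change F a.val = F b.val at hab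
    have ha := hval a
    have hb := hval b
    apply Subtype.ext
    revert ha hb hab
    generalize a.val = a
    generalize b.val = b
    intro hab ha hb
    have hdep : spiderDepth a = spiderDepth b := by
      have key : ∀ v : Option (Fin p × Fin m),
          (∀ i j, v = some (i, j) → (j : ℕ) + 1 ≤ G.dist c (z i)) →
            G.dist c (F v) = spiderDepth v := by
        rintro (_ | ⟨i, j⟩) hv
        · simp [hF, spiderDepth]
        · exact hc i _ (hv i j rfl)
      rw [← key a ha, ← key b hb, hab]
    rcases a with _ | ⟨i, j⟩ <;> rcases b with _ | ⟨i', j'⟩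
    · rfl
    · simp [spiderDepth] at hdep
    · simp [spiderDepth] at hdep
    · simp only [spiderDepth] at hdep
      have hjj : j = j' := Fin.ext (by omega)
      subst hjj
      -- Legs meeting at depth j + 1 would give d(z i, z i') ≤ 2m - 2(j + 1), below the assumed 2m -
      -- 1.
      have hii : i = i' := by
        by_contra hne
        have h1 := hend i (j + 1) (ha i j rfl)
        have h2 := hend i' (j + 1) (hb i' j rfl)
        have h3 := hG.connected.dist_triangle (u := z i) (v := w i (j + 1)) (w := z i')
        have h4 := hz i i' hne
        have hab' : w i (j + 1) = w i' (j + 1) := hab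
        rw [G.dist_comm (u := z i) (v := w i (j + 1)), h1, hab', h2] at h3
        have := hle i
        have := hle i'
        omega
      rw [hii]

end SpiderMinus

/-! ### A tree attaining the bound -/

section Existence

open SimpleGraph

/-- A spider with pendant vertices at its centre attaining the minimum. -/
lemma exists_isTree_mdi_add_le {h p : ℕ} (hh : 1 ≤ h) (hp : 2 ≤ p) (r : ℕ) :
    ∃ G : SimpleGraph (SpiderMinusVertex p (h + 1) ⊕ Fin r), G.IsTree ∧
      mdi G (2 * h) + p ≤ p * (h + 1) + r + 1 := by
  -- Inside a spider with `p + r` legs, the first `p` legs carry S' and each of the last `r` only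
  -- its innermost vertex.
  set φ : SpiderMinusVertex p (h + 1) ⊕ Fin r → Option (Fin (p + r) × Fin (h + 1)) :=
    Sum.elim (fun v => v.val.map (Prod.map (Fin.castAdd r) id))
      (fun t => some (Fin.natAdd p t, 0)) with hφdef
  have hl : ∀ v i j, φ (Sum.inl v) = some (i, j) → ∃ i', i = Fin.castAdd r i' ∧
      v.val = some (i', j) := by
    rintro ⟨v, hv⟩ i j hij
    rcases v with _ | ⟨i', j'⟩
    · simp [hφdef] at hij
    · simp only [hφdef, Sum.elim_inl, Option.map_some, Prod.map_apply, id_eq, Option.some.injEq,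
        Prod.mk.injEq] at hij
      exact ⟨i', hij.1.symm, congrArg (fun t => some (i', t)) hij.2⟩
  have hr : ∀ t i j, φ (Sum.inr t) = some (i, j) → i = Fin.natAdd p t ∧ j = 0 := by
    intro t i j hij
    simp only [hφdef, Sum.elim_inr, Option.some.injEq, Prod.mk.injEq] at hij
    exact ⟨hij.1.symm, hij.2.symm⟩
  have hinj : Function.Injective φ := by
    rintro (a | a) (b | b) hab
    · congr 1
      apply Subtype.ext
      refine Option.map_injective ?_ hab
      exact (Fin.castAdd_injective p r).prodMap Function.injective_id
    · obtain ⟨i', h1, -⟩ := hl a _ _ hab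
      have := congrArg Fin.val h1
      simp at this
      omega
    · obtain ⟨i', h1, -⟩ := hl b _ _ hab.symm
      have := congrArg Fin.val h1
      simp at this
      omega
    · have := (hr a _ _ hab).1
      have := congrArg Fin.val this
      simp at this
      rw [Fin.ext this]
  have hc : φ (Sum.inl (SpiderMinusVertex.center p (h + 1))) = none := rfl
  have hdown : ∀ w i (j j' : Fin (h + 1)), φ w = some (i, j) → (j' : ℕ) + 1 = j →
      ∃ w', φ w' = some (i, j') := by
    rintro (v | t) i j j' hw hj
    · obtain ⟨i', rfl, hv⟩ := hl v i j hw
      obtain ⟨w', hw'⟩ := spiderMinus_down v i' j j' hv hj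
      exact ⟨Sum.inl w', by simp [hφdef, hw']⟩
    · obtain ⟨-, rfl⟩ := hr t i j hw
      simp at hj
  set G := (spider (p + r) (h + 1)).comap φ
  have hupp : ∀ u v, G.dist u v ≤ spiderDepth (φ u) + spiderDepth (φ v) :=
    dist_spider_comap_le hinj hc hdown
  have hlow : ∀ {u v i i'} {j j' : Fin (h + 1)}, φ u = some (i, j) → φ v = some (i', j') → i ≠ i' →
      (j : ℕ) + 1 + (j' + 1) ≤ G.dist u v := le_dist_spider_comap hinj hc hdown
  set L : Set (SpiderMinusVertex p (h + 1) ⊕ Fin r) := {w | spiderDepth (φ w) = h + 1} with hL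
  have hLv : ∀ w ∈ L, ∃ i, φ w = some (i, Fin.last h) := by
    intro w hw
    have hw' : spiderDepth (φ w) = h + 1 := hw
    rcases hφw : φ w with _ | ⟨i, j⟩
    · simp [hφw, spiderDepth] at hw'
    · simp only [hφw, spiderDepth] at hw'
      exact ⟨i, by rw [show j = Fin.last h from Fin.ext (by simp; omega)]⟩
  have hind : IsDistIndep G (2 * h) L := by
    intro u v hu hv huv
    obtain ⟨i, hi⟩ := hLv u hu
    obtain ⟨i', hi'⟩ := hLv v hv
    have := hlow hi hi' (by
      rintro rfl
      exact huv (hinj (hi.trans hi'.symm)))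
    simp only [Fin.val_last] at this
    omega
  have hnear : ∀ u v, u ∉ L → v ∉ L → G.dist u v ≤ 2 * h := by
    intro u v hu hv
    have h1 := hupp u v
    have h2 : spiderDepth (φ u) ≠ h + 1 := hu
    have h3 : spiderDepth (φ v) ≠ h + 1 := hv
    have h4 := spiderDepth_le (φ u)
    have h5 := spiderDepth_le (φ v)
    omega
  -- The end of the short leg has depth `h` (index h - 1), hence distance h + (h + 1) = k + 1 from
  -- every full tip. So `L` is not maximal and contributes no set of its own.
  set s : SpiderMinusVertex p (h + 1) := SpiderMinusVertex.mk ⟨p - 1, by omega⟩ ⟨h - 1, by omega⟩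
    (by simp; omega) with hs
  have hφs : φ (Sum.inl s) = some (Fin.castAdd r ⟨p - 1, by omega⟩, ⟨h - 1, by omega⟩) := rfl
  have hsL : Sum.inl s ∉ L := by
    intro hsL
    obtain ⟨i, hi⟩ := hLv _ hsL
    rw [hφs] at hi
    simp only [Option.some.injEq, Prod.mk.injEq, Fin.ext_iff, Fin.val_last] at hi
    omega
  have hsfar : ∀ l ∈ L, 2 * h + 1 ≤ G.dist (Sum.inl s) l := by
    intro l hlL
    obtain ⟨i, hi⟩ := hLv l hlL
    have := hlow hφs hi (by
      rintro rfl
      rcases l with v | t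
      · obtain ⟨i', h1, h2⟩ := hl v _ _ hi
        have h3 := v.2 _ _ h2
        have := congrArg Fin.val h1
        simp at this h3
        omega
      · have := congrArg Fin.val (hr t _ _ hi).2
        simp at this
        omega)
    simp only [Fin.val_last] at this
    omega
  have hcount := mdi_add_ncard_of_far_vertex hind hnear hsL hsfar
  rw [Nat.card_sum, Nat.card_fin, card_spiderMinusVertex (by omega) (by omega)] at hcount
  have hLcard : p - 1 ≤ L.ncard := by
    have := Nat.card_le_card_of_injective
      (fun i : Fin (p - 1) => (⟨Sum.inl (SpiderMinusVertex.mk ⟨i, by omega⟩ (Fin.last h)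
        (by simp; omega)), rfl⟩ : L)) (fun a b hab => by
          simp only [Subtype.mk.injEq, Sum.inl.injEq, SpiderMinusVertex.mk, Option.some.injEq,
            Prod.mk.injEq, Fin.mk.injEq, and_true] at hab
          exact Fin.ext hab)
    rwa [Nat.card_fin, Nat.card_coe_set_eq] at this
  exact ⟨G, isTree_spider_comap hinj hc hdown, by omega⟩

end Existence

/-! ### The minimum value -/

section Minimal

open SimpleGraph

variable {V : Type*} [Finite V] {T : SimpleGraph V} {h : ℕ}

lemma minMdi_of_le {k n : ℕ} (hn : n ≤ k + 1) : minMdi k n = n := if_pos hn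

lemma minMdi_add_div {n : ℕ} (hn : 2 * h + 2 ≤ n) :
    minMdi (2 * h) n + n / (h + 1) = n + 1 := by
  have h1 : n / (h + 1) ≤ n := Nat.div_le_self _ _
  rw [minMdi, if_neg (by omega), Nat.mul_mod_right, Nat.sub_zero, Nat.mul_div_cancel_left _ two_pos]
  omega

lemma SimpleGraph.IsTree.mdi_eq_card_of_card_le {k : ℕ} (hT : T.IsTree)
    (hn : Nat.card V ≤ k + 1) : mdi T k = Nat.card V := by
  have := hT.connected.nonempty
  refine mdi_eq_card fun u v => ?_
  have := hT.connected.dist_lt_card u v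
  omega

lemma SimpleGraph.IsTree.minMdi_le_mdi (hT : T.IsTree) :
    minMdi (2 * h) (Nat.card V) ≤ mdi T (2 * h) := by
  by_cases hn : Nat.card V ≤ 2 * h + 1
  · rw [minMdi_of_le hn, hT.mdi_eq_card_of_card_le hn]
  · have h1 := minMdi_add_div (h := h) (n := Nat.card V) (by omega)
    have h2 := hT.card_lt_mdi_add (h := h) rfl (by omega)
    omega

lemma exists_isTree_mdi_eq_minMdi (V : Type*) [Finite V] [Nonempty V] (hh : 1 ≤ h) :
    ∃ T : SimpleGraph V, T.IsTree ∧ mdi T (2 * h) = minMdi (2 * h) (Nat.card V) := by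
  have htransfer : ∀ (W : Type) [Finite W] (G : SimpleGraph W), Nat.card W = Nat.card V →
      G.IsTree → ∃ T : SimpleGraph V, T.IsTree ∧ mdi T (2 * h) = mdi G (2 * h) := by
    intro W _ G hW hG
    have e : V ≃ W :=
      (Finite.equivFinOfCardEq rfl).trans (Finite.equivFinOfCardEq hW).symm
    exact ⟨G.comap e, (Iso.comap e G).isTree_iff.2 hG, mdi_congr (Iso.comap e G) _⟩
  by_cases hn : Nat.card V ≤ 2 * h + 1
  · obtain ⟨T, -, hT⟩ := (connected_top (V := V)).exists_isTree_le
    exact ⟨T, hT, by rw [minMdi_of_le hn, hT.mdi_eq_card_of_card_le hn]⟩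
  · have h1 := minMdi_add_div (h := h) (n := Nat.card V) (by omega)
    have hp : 2 ≤ Nat.card V / (h + 1) := (Nat.le_div_iff_mul_le (by omega)).2 (by omega)
    have hdm := Nat.div_add_mod' (Nat.card V) (h + 1)
    obtain ⟨G, hG, hGm⟩ := exists_isTree_mdi_add_le hh hp (Nat.card V % (h + 1))
    obtain ⟨T, hT, hTm⟩ := htransfer _ G (by
      rw [Nat.card_sum, Nat.card_fin, card_spiderMinusVertex (by omega) (by omega), hdm]) hG
    have h2 := hT.minMdi_le_mdi (h := h)
    exact ⟨T, hT, by omega⟩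

lemma isKMinimal_iff [Nonempty V] (hh : 1 ≤ h) :
    IsKMinimal T (2 * h) ↔ T.IsTree ∧ mdi T (2 * h) = minMdi (2 * h) (Nat.card V) := by
  constructor
  · rintro ⟨hT, hmin⟩
    obtain ⟨T', hT', hm⟩ := exists_isTree_mdi_eq_minMdi V hh
    exact ⟨hT, (hm ▸ hmin T' hT').antisymm hT.minMdi_le_mdi⟩
  · rintro ⟨hT, hm⟩
    exact ⟨hT, fun T' hT' => hm ▸ hT'.minMdi_le_mdi⟩

lemma isKMinimal_iff_add_div [Nonempty V] (hh : 1 ≤ h) (hn : 2 * h + 2 ≤ Nat.card V) :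
    IsKMinimal T (2 * h) ↔
      T.IsTree ∧ mdi T (2 * h) + Nat.card V / (h + 1) = Nat.card V + 1 := by
  rw [isKMinimal_iff hh]
  have := minMdi_add_div hn
  refine and_congr_right fun _ => ⟨fun _ => by omega, fun _ => by omega⟩

end Minimal

/-! ### Classification of minimal trees by diameter -/

section Classification

open SimpleGraph

variable {V : Type*} [Finite V] {T : SimpleGraph V} {k h : ℕ}

lemma SimpleGraph.IsTree.exists_isDiametralLeaf (hT : T.IsTree) (hd : T.diam ≠ 0) :
    ∃ x y, T.dist x y = T.diam ∧ IsDiametralLeaf T x ∧ IsDiametralLeaf T y := by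
  have := nontrivial_of_diam_ne_zero hd
  obtain ⟨x, y, hxy⟩ := T.exists_dist_eq_diam
  exact ⟨x, y, hxy, (hT.isDiametralLeaf_iff x).2 ⟨y, hxy⟩,
    (hT.isDiametralLeaf_iff y).2 ⟨x, by rw [dist_comm, hxy]⟩⟩

lemma mem_closedNbhd_self {V : Type*} {T : SimpleGraph V} (v : V) : v ∈ closedNbhd T k v := by simp [closedNbhd]

/-- Trees of diameter `k + 1` without special pairs. -/
lemma SimpleGraph.IsTree.mdi_of_no_specialPair (hT : T.IsTree) (hk : k = 2 * h)
    (hd : T.diam = k + 1) (hs : ∀ x y, ¬ IsKSpecialPair T k x y) : mdi T k + 1 = Nat.card V := by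
  have hmax : ∀ u v, T.dist u v ≤ k + 1 := fun u v => hd ▸ hT.connected.dist_le_diam_of_finite u v
  obtain ⟨x, y, hxy, hx, hy⟩ := hT.exists_isDiametralLeaf (by omega)
  rw [hd] at hxy
  by_cases htx : IsKTwin T k x
  · by_cases hty : IsKTwin T k y
    · refine absurd ⟨⟨hx, htx⟩, ⟨hy, hty⟩, fun hN => ?_⟩ (hs x y)
      have : T.dist x y ≤ k := by
        have : y ∈ closedNbhd T k x := hN ▸ mem_closedNbhd_self y
        exact this
      omega
    · exact hT.mdi_of_diam_eq_add_one hk hmax (by rwa [dist_comm]) hty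
  · exact hT.mdi_of_diam_eq_add_one hk hmax hxy htx

/-- `x` is far from `y`, hence also from a twin `z` of `y`; the pair `y`, `z` is close, so deleting
`x` loses two sets. -/
lemma SimpleGraph.IsTree.card_add_two_le_of_specialPair (hT : T.IsTree) (hk : k = 2 * h)
    (hd : T.diam = k + 1) (hcard : h + 2 ≤ Nat.card V) {x y : V} (hs : IsKSpecialPair T k x y) :
    Nat.card V + 2 ≤ mdi T k + Nat.card V / (h + 1) := by
  have hmax : ∀ u v, T.dist u v ≤ k + 1 := fun u v => hd ▸ hT.connected.dist_le_diam_of_finite u v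
  have := nontrivial_of_diam_ne_zero (G := T) (by omega)
  obtain ⟨⟨hx, htx⟩, ⟨hy, z, hzy, hyz⟩, hN⟩ := hs
  obtain ⟨w, hw⟩ := (hT.isDiametralLeaf_iff x).1 hx
  obtain ⟨w', hw'⟩ := (hT.isDiametralLeaf_iff y).1 hy
  rw [hd] at hw hw'
  have hxy : k + 1 ≤ T.dist x y := by
    by_contra hcon
    exact hN (hT.closedNbhd_eq hmax hw hw' (by omega))
  have hxz : k + 1 ≤ T.dist x z := by
    by_contra hcon
    have h1 : x ∈ closedNbhd T k z := by
      change T.dist z x ≤ k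
      rw [dist_comm]
      omega
    rw [← hyz] at h1
    have h2 : T.dist y x ≤ k := h1
    rw [dist_comm] at h2
    omega
  have hyz' : T.dist y z ≤ k := by
    have : z ∈ closedNbhd T k y := hyz ▸ mem_closedNbhd_self z
    exact this
  exact hT.card_add_two_le_of_twin hk hcard (w := w) (fun u v => hw ▸ hmax u v) htx hxy hxz
    hzy.symm hyz'

/-- The last two vertices of a longest path from `x` are at distances k + 1 and k + 2 from `x` and
adjacent, so no second twin class is needed. -/
lemma SimpleGraph.IsTree.card_add_two_le_of_diametralTwin (hT : T.IsTree) (hk : k = 2 * h)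
    (hh : 1 ≤ h) (hd : T.diam = k + 2) (hcard : h + 2 ≤ Nat.card V) {x : V}
    (hx : IsDiametralKTwin T k x) :
    Nat.card V + 2 ≤ mdi T k + Nat.card V / (h + 1) := by
  have hmax : ∀ u v, T.dist u v ≤ k + 2 := fun u v => hd ▸ hT.connected.dist_le_diam_of_finite u v
  have := nontrivial_of_diam_ne_zero (G := T) (by omega)
  obtain ⟨w, hw⟩ := (hT.isDiametralLeaf_iff x).1 hx.1
  rw [hd] at hw
  obtain ⟨b, hb, hbw⟩ := hT.connected.exists_dist_eq x w (t := k + 1) (by omega)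
  refine hT.card_add_two_le_of_twin hk hcard (w := w) (fun u v => hw ▸ hmax u v) hx.2 (a := b)
    (b := w) (by omega) (by omega) ?_ (by omega)
  rintro rfl
  omega

/-- The ends of the longest paths. -/
abbrev SimpleGraph.diametralEnds {V : Type*} (T : SimpleGraph V) (k : ℕ) : Set V :=
  {v | ∃ w, T.dist v w = k + 2}

/-- The number of maximal distance-`k` independent sets of a tree of diameter `k + 2` without
diametral twins. -/
lemma SimpleGraph.IsTree.mdi_of_no_diametralTwin (hT : T.IsTree)
    (hd : T.diam = k + 2) (ht : ∀ v, ¬ IsDiametralKTwin T k v) :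
    IsDistIndep T k (T.diametralEnds k) ∧
    ((∃ v ∉ T.diametralEnds k, ∀ l ∈ T.diametralEnds k, k + 1 ≤ T.dist v l) ∧
      mdi T k + (T.diametralEnds k).ncard = Nat.card V ∨
    (¬ ∃ v ∉ T.diametralEnds k, ∀ l ∈ T.diametralEnds k, k + 1 ≤ T.dist v l) ∧
      mdi T k + (T.diametralEnds k).ncard = Nat.card V + 1) := by
  have hmax : ∀ u v, T.dist u v ≤ k + 2 := fun u v => hd ▸ hT.connected.dist_le_diam_of_finite u v
  have := nontrivial_of_diam_ne_zero (G := T) (by omega)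
  obtain ⟨x, y, hxy⟩ := T.exists_dist_eq_diam
  have hind : IsDistIndep T k (T.diametralEnds k) := hT.isDistIndep_ends hmax fun u v huv htw =>
    ht u ⟨(hT.isDiametralLeaf_iff u).2 ⟨v, by rw [huv, hd]⟩, htw⟩
  have hnear := hT.dist_le_of_not_ends hmax (hxy.trans hd)
  refine ⟨hind, ?_⟩
  by_cases hfar : ∃ v ∉ T.diametralEnds k, ∀ l ∈ T.diametralEnds k, k + 1 ≤ T.dist v l
  · obtain ⟨v, hv, hvl⟩ := hfar
    exact Or.inl ⟨⟨v, hv, hvl⟩, mdi_add_ncard_of_far_vertex hind hnear hv hvl⟩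
  · refine Or.inr ⟨hfar, mdi_add_ncard_of_forall_near hind hnear fun v hv => ?_⟩
    by_contra! hcon
    exact hfar ⟨v, hv, fun l hl => hcon l hl⟩

/-- The midpoint `c` of a longest path has eccentricity h + 1, so ends of longest paths have depth
exactly h + 1. The last `z i` is only required to be far from the others, which gives depth at least
`h`: enough for the shortened leg. -/
lemma SimpleGraph.IsTree.spiderMinus_isContained_of_ends (hT : T.IsTree) (hk : k = 2 * h)
    (hd : T.diam = k + 2) {p : ℕ} (hp : 2 ≤ p) (z : Fin p → V)
    (hz : ∀ i : Fin p, (i : ℕ) + 1 < p → z i ∈ T.diametralEnds k)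
    (hzz : ∀ i j, i ≠ j → k + 1 ≤ T.dist (z i) (z j)) :
    (spiderMinus p (h + 1)).IsContained T := by
  have hmax : ∀ u v, T.dist u v ≤ k + 2 := fun u v => hd ▸ hT.connected.dist_le_diam_of_finite u v
  have := nontrivial_of_diam_ne_zero (G := T) (by omega)
  obtain ⟨x, y, hxy⟩ := T.exists_dist_eq_diam
  rw [hd] at hxy
  obtain ⟨c, hxc, hcy⟩ := hT.connected.exists_dist_eq x y (t := h + 1) (by omega)
  have comm := fun a b => T.dist_comm (u := a) (v := b)
  have hc : ∀ v, T.dist c v ≤ h + 1 := by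
    intro v
    have h1 := hT.four_point x y c v
    have h2 := hmax x v
    have h3 := hmax y v
    rw [comm y c] at h1
    omega
  have hge : ∀ i : Fin p, (i : ℕ) + 1 < p → h + 1 ≤ T.dist c (z i) := by
    intro i hi
    obtain ⟨w, hw⟩ := hz i hi
    have h1 := hT.connected.dist_triangle (u := z i) (v := c) (w := w)
    have h2 := hc w
    rw [comm (z i) c] at h1
    omega
  refine hT.spiderMinus_isContained c z (fun i => hc _) hge (fun i => ?_) (fun i j hij => ?_)
  · obtain ⟨j, hj⟩ : ∃ j : Fin p, i ≠ j := by
      have : Nontrivial (Fin p) := Fin.nontrivial_iff_two_le.2 hp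
      obtain ⟨j, hj⟩ := exists_ne i
      exact ⟨j, hj.symm⟩
    have h1 := hzz i j hj
    have h2 := hT.connected.dist_triangle (u := z i) (v := c) (w := z j)
    have h3 := hc (z j)
    rw [comm (z i) c] at h2
    omega
  · have := hzz i j hij
    omega

/-- For trees of diameter `k + 2` without diametral twins, minimality forces a large spider. -/
lemma SimpleGraph.IsTree.spiderMinus_isContained_of_mdi (hT : T.IsTree) (hk : k = 2 * h)
    (hd : T.diam = k + 2) (ht : ∀ v, ¬ IsDiametralKTwin T k v) {p : ℕ} (hp : 2 ≤ p)
    (hm : mdi T k + p = Nat.card V + 1) : (spiderMinus p (h + 1)).IsContained T := by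
  obtain ⟨hind, ⟨⟨v, hv, hvl⟩, hcount⟩ | ⟨-, hcount⟩⟩ := hT.mdi_of_no_diametralTwin hd ht
  -- The far vertex `v` ends the short leg and the p - 1 diametral ends give the full ones. In the
  -- other case there are `p` diametral ends.
  · have hcard : Nat.card (T.diametralEnds k) = p - 1 := by
      rw [Nat.card_coe_set_eq]
      omega
    set e := (Finite.equivFinOfCardEq hcard).symm
    refine hT.spiderMinus_isContained_of_ends hk hd hp
      (fun i => if hi : (i : ℕ) + 1 < p then (e ⟨i, by omega⟩ : V) else v)
      (fun i hi => ?_) (fun i j hij => ?_)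
    · simp only [dif_pos hi]
      exact (e _).2
    · by_cases hi : (i : ℕ) + 1 < p
      · by_cases hj : (j : ℕ) + 1 < p
        · simp only [dif_pos hi, dif_pos hj]
          refine hind (e _).2 (e _).2 fun heq => hij ?_
          have := e.injective (Subtype.ext heq)
          simp only [Fin.mk.injEq] at this
          exact Fin.ext this
        · simp only [dif_pos hi, dif_neg hj]
          rw [dist_comm]
          exact hvl _ (e _).2
      · have hj : (j : ℕ) + 1 < p := by
          by_contra hj
          exact hij (Fin.ext (by omega))
        simp only [dif_neg hi, dif_pos hj]
        exact hvl _ (e _).2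
  · have hcard : Nat.card (T.diametralEnds k) = p := by
      rw [Nat.card_coe_set_eq]
      omega
    set e := (Finite.equivFinOfCardEq hcard).symm
    exact hT.spiderMinus_isContained_of_ends hk hd hp (fun i => e i) (fun i _ => (e i).2)
      fun i j hij => hind (e i).2 (e j).2 fun heq => hij (e.injective (Subtype.ext heq))

/-- For trees of diameter `k + 2` without diametral twins, a large spider implies minimality. -/
lemma SimpleGraph.IsTree.mdi_add_le_of_spiderMinus (hT : T.IsTree) (hk : k = 2 * h) (hh : 1 ≤ h)
    (hd : T.diam = k + 2) (ht : ∀ v, ¬ IsDiametralKTwin T k v) {p : ℕ} (hp : 3 ≤ p)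
    (hS : (spiderMinus p (h + 1)).IsContained T) : mdi T k + p ≤ Nat.card V + 1 := by
  obtain ⟨f⟩ := hS
  have hmax : ∀ u v, T.dist u v ≤ k + 2 := fun u v => hd ▸ hT.connected.dist_le_diam_of_finite u v
  have hf := hT.dist_copy connected_spiderMinus f
  set tip : Fin (p - 1) → SpiderMinusVertex p (h + 1) := fun i =>
    SpiderMinusVertex.mk ⟨i, by omega⟩ (Fin.last h) (by simp; omega) with htip
  have htipinj : Function.Injective tip := fun a b hab => by
    simp only [htip, SpiderMinusVertex.mk, Subtype.mk.injEq, Option.some.injEq, Prod.mk.injEq,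
      Fin.mk.injEq, and_true] at hab
    exact Fin.ext hab
  have htipdist : ∀ i j, i ≠ j → k + 2 ≤ T.dist (f (tip i)) (f (tip j)) := by
    intro i j hij
    rw [hf]
    refine le_trans ?_ (le_dist_spiderMinus ?_)
    · simp only [Fin.val_last]
      omega
    · simpa [Fin.ext_iff] using hij
  have htipL : ∀ i, f (tip i) ∈ T.diametralEnds k := by
    intro i
    -- Here `p ≥ 3` is needed: a second full leg makes each tip an end of a longest path.
    have : Nontrivial (Fin (p - 1)) := Fin.nontrivial_iff_two_le.2 (by omega)
    obtain ⟨j, hj⟩ := exists_ne i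
    exact ⟨f (tip j), (hmax _ _).antisymm (htipdist i j hj.symm)⟩
  have hrange : Set.range (fun i => f (tip i)) ⊆ T.diametralEnds k := by
    rintro _ ⟨i, rfl⟩
    exact htipL i
  have hfinj : Function.Injective fun i => f (tip i) := fun a b hab => htipinj (f.injective hab)
  have hrcard : (Set.range (fun i => f (tip i))).ncard = p - 1 := by
    rw [← Nat.card_coe_set_eq, Nat.card_range_of_injective hfinj, Nat.card_fin]
  have hle := Set.ncard_le_ncard hrange
  obtain ⟨-, ⟨-, hcount⟩ | ⟨hfar, hcount⟩⟩ := hT.mdi_of_no_diametralTwin hd ht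
  · omega
  · by_contra hcon
    have heq := Set.eq_of_subset_of_ncard_le hrange (by omega)
    set s : SpiderMinusVertex p (h + 1) := SpiderMinusVertex.mk ⟨p - 1, by omega⟩
      ⟨h - 1, by omega⟩ (by simp; omega) with hs
    refine hfar ⟨f s, ?_, ?_⟩ <;> rw [← heq]
    · rintro ⟨i, hi⟩
      have := f.injective hi
      simp only [htip, hs, SpiderMinusVertex.mk, Subtype.mk.injEq, Option.some.injEq,
        Prod.mk.injEq, Fin.mk.injEq] at this
      omega
    · rintro _ ⟨i, rfl⟩
      simp only
      rw [hf]
      refine le_trans ?_ (le_dist_spiderMinus ?_)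
      · simp only [Fin.val_last]
        omega
      · simp only [ne_eq, Fin.mk.injEq]
        omega

/-- Both ends of a longest path are diametral, so at least two vertices are saved; this settles
quotient 2. -/
lemma SimpleGraph.IsTree.mdi_add_two_le (hT : T.IsTree)
    (hd : T.diam = k + 2) (ht : ∀ v, ¬ IsDiametralKTwin T k v) :
    mdi T k + 2 ≤ Nat.card V + 1 := by
  have := nontrivial_of_diam_ne_zero (G := T) (by omega)
  obtain ⟨x, y, hxy⟩ := T.exists_dist_eq_diam
  have hsub : {x, y} ⊆ T.diametralEnds k := by
    rintro _ (rfl | rfl)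
    · exact ⟨y, by omega⟩
    · exact ⟨x, by rw [dist_comm]; omega⟩
  have hle := Set.ncard_le_ncard hsub
  rw [Set.ncard_pair (by rintro rfl; rw [dist_self] at hxy; omega)] at hle
  obtain ⟨-, ⟨-, hcount⟩ | ⟨-, hcount⟩⟩ := hT.mdi_of_no_diametralTwin hd ht <;> omega

/-- A minimal tree on at least `k + 2` vertices has diameter `k + 1` or `k + 2`. -/
lemma SimpleGraph.IsTree.diam_of_mdi (hT : T.IsTree) (hk : k = 2 * h) (hh : 1 ≤ h)
    (hn : k + 2 ≤ Nat.card V) (hm : mdi T k + Nat.card V / (h + 1) = Nat.card V + 1) :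
    T.diam = k + 1 ∨ T.diam = k + 2 := by
  have := hT.connected.nonempty
  have hle := hT.connected.dist_le_diam_of_finite
  have hp : 2 ≤ Nat.card V / (h + 1) := (Nat.le_div_iff_mul_le (by omega)).2 (by omega)
  by_contra hcon
  push Not at hcon
  rcases le_or_gt T.diam k with hd | hd
  · have := mdi_eq_card (G := T) (k := k) fun u v => (hle u v).trans hd
    omega
  · obtain ⟨x, y, hxy⟩ := T.exists_dist_eq_diam
    have := hT.card_add_two_le_of_three_le hk hh (x := x) (y := y) (fun u v => hxy ▸ hle u v)
      (by omega)
    omega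

end Classification

/-! ### The theorem -/

theorem theorem1 (k : ℕ) (hk : Even k) (hk2 : 2 ≤ k) (n : ℕ) (hn : 1 ≤ n) :
    IsLeast {m : ℕ | ∃ T : SimpleGraph (Fin n), T.IsTree ∧ mdi T k = m} (minMdi k n) ∧
    ∀ (V : Type*) [Finite V], Nat.card V = n → ∀ T : SimpleGraph V,
      (IsKMinimal T k → mdi T k = minMdi k n) ∧
      (n ≤ k + 1 → T.IsTree → IsKMinimal T k) ∧
      (n = k + 2 → (IsKMinimal T k ↔ Nonempty (T ≃g SimpleGraph.pathGraph (k + 2)))) ∧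
      (k + 3 ≤ n → n ≤ 3 * k / 2 + 2 →
        (IsKMinimal T k ↔
          MemAddStar k (SimpleGraph.pathGraph (k + 2)) (n - k - 2) T ∨
          MemAdd k (SimpleGraph.pathGraph (k + 3)) (n - k - 3) T)) ∧
      (3 * k / 2 + 3 ≤ n →
        (IsKMinimal T k ↔
          MemAdd k (spiderMinus (n / (k / 2 + 1)) (k / 2 + 1)) (n % (k / 2 + 1)) T)) := by
  obtain ⟨h, rfl⟩ : ∃ h, k = 2 * h := ⟨k / 2, by obtain ⟨c, hc⟩ := hk; omega⟩
  have hh : 1 ≤ h := by omega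
  have hhalf : 2 * h / 2 = h := by omega
  constructor
  · have : Nonempty (Fin n) := ⟨⟨0, hn⟩⟩
    refine ⟨?_, ?_⟩
    · obtain ⟨T, hT, hm⟩ := exists_isTree_mdi_eq_minMdi (Fin n) hh
      rw [Nat.card_fin] at hm
      exact ⟨T, hT, hm⟩
    · rintro _ ⟨T, hT, rfl⟩
      have := hT.minMdi_le_mdi (h := h)
      rwa [Nat.card_fin] at this
  intro V _ hV T
  subst hV
  have hne : Nonempty V := (Nat.card_pos_iff.1 hn).1
  refine ⟨fun hT => ((isKMinimal_iff hh).1 hT).2, fun hle hT => ?_, fun heq => ?_,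
    fun hge hle => ?_, fun hge => ?_⟩
  · exact (isKMinimal_iff hh).2 ⟨hT, by rw [minMdi_of_le hle, hT.mdi_eq_card_of_card_le hle]⟩
  · have hp : Nat.card V / (h + 1) = 2 := by
      rw [heq, show 2 * h + 2 = 2 * (h + 1) by ring, Nat.mul_div_cancel _ (by omega)]
    have hiff : ∀ T : SimpleGraph V, T.IsTree → T.diam = 2 * h + 1 →
        Nonempty (T ≃g SimpleGraph.pathGraph (2 * h + 2)) := by
      intro T hT hd
      obtain ⟨x, y, hxy⟩ := T.exists_dist_eq_diam
      exact hT.connected.nonempty_iso_pathGraph (hxy.trans hd) heq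
    have hmin : ∀ T : SimpleGraph V, IsKMinimal T (2 * h) →
        Nonempty (T ≃g SimpleGraph.pathGraph (2 * h + 2)) := by
      intro T hT
      obtain ⟨hT, hm⟩ := (isKMinimal_iff_add_div hh (by omega)).1 hT
      rcases hT.diam_of_mdi rfl hh (by omega) hm with hd | hd
      · exact hiff T hT hd
      · obtain ⟨x, y, hxy⟩ := T.exists_dist_eq_diam
        have := hT.connected.dist_lt_card x y
        omega
    refine ⟨hmin T, fun ⟨e⟩ => ?_⟩
    -- The path needs no count: some minimal tree exists, and it must be the path.
    obtain ⟨T', hT', hm'⟩ := exists_isTree_mdi_eq_minMdi V hh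
    obtain ⟨e'⟩ := hmin T' ((isKMinimal_iff hh).2 ⟨hT', hm'⟩)
    rw [isKMinimal_iff hh, SimpleGraph.Iso.isTree_iff (e.trans e'.symm), mdi_congr (e.trans e'.symm)]
    exact ⟨hT', hm'⟩
  -- This range of orders is exactly where the quotient is 2, apart from order k + 2; the minimum is
  -- n - 1.
  · have hp : Nat.card V / (h + 1) = 2 := by
      rw [Nat.div_eq_iff (by omega)]
      omega
    rw [isKMinimal_iff_add_div hh (by omega)]
    constructor
    · rintro ⟨hT, hm⟩
      have hpath : ∀ d, T.diam = d → (SimpleGraph.pathGraph (d + 1)).IsContained T := by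
        rintro d rfl
        obtain ⟨x, y, hxy⟩ := T.exists_dist_eq_diam
        rw [← hxy]
        exact hT.connected.pathGraph_isContained x y
      rcases hT.diam_of_mdi rfl hh (by omega) hm with hd | hd
      · refine Or.inl ⟨hT, ?_, by rw [hd, diam_pathGraph], hpath _ hd, fun x y hs => ?_⟩
        · rw [Nat.card_fin]
          omega
        · have := hT.card_add_two_le_of_specialPair rfl hd (by omega) hs
          omega
      · refine Or.inr ⟨hT, ?_, by rw [hd, diam_pathGraph], hpath _ hd, fun x hs => ?_⟩
        · rw [Nat.card_fin]
          omega
        · have := hT.card_add_two_le_of_diametralTwin rfl hh hd (by omega) hs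
          omega
    · rintro (⟨hT, -, hd, -, hs⟩ | ⟨hT, -, hd, -, ht⟩) <;> rw [diam_pathGraph] at hd
      · have := hT.mdi_of_no_specialPair rfl hd hs
        exact ⟨hT, by omega⟩
      · have h1 := hT.mdi_add_two_le hd ht
        have h2 := hT.card_lt_mdi_add (h := h) rfl (by omega)
        exact ⟨hT, by omega⟩
  · have hp : 3 ≤ Nat.card V / (h + 1) := (Nat.le_div_iff_mul_le (by omega)).2 (by omega)
    generalize 2 * h / 2 = q at hhalf
    obtain rfl : h = q := hhalf.symm
    rw [isKMinimal_iff_add_div hh (by omega)]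
    constructor
    · rintro ⟨hT, hm⟩
      have hd : T.diam = 2 * h + 2 := by
        -- Diameter k + 1 is too expensive: a special pair exceeds the bound, and without one the
        -- count is n - 1, above n + 1 - p since p ≥ 3.
        refine (hT.diam_of_mdi rfl hh (by omega) hm).resolve_left fun hd => ?_
        by_cases hs : ∃ x y, IsKSpecialPair T (2 * h) x y
        · obtain ⟨x, y, hs⟩ := hs
          have := hT.card_add_two_le_of_specialPair rfl hd (by omega) hs
          omega
        · push Not at hs
          have := hT.mdi_of_no_specialPair rfl hd hs
          omega
      have ht : ∀ v, ¬ IsDiametralKTwin T (2 * h) v := fun v hv => by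
        have := hT.card_add_two_le_of_diametralTwin rfl hh hd (by omega) hv
        omega
      refine ⟨hT, ?_, ?_, hT.spiderMinus_isContained_of_mdi rfl hd ht (by omega) hm, ht⟩
      · rw [card_spiderMinusVertex (by omega) (by omega), Nat.div_add_mod']
      · rw [hd, diam_spiderMinus hp (by omega)]
        ring
    · rintro ⟨hT, -, hd, hS, ht⟩
      rw [diam_spiderMinus hp (by omega)] at hd
      have h1 := hT.mdi_add_le_of_spiderMinus rfl hh hd ht hp hS
      have h2 := hT.card_lt_mdi_add (h := h) rfl (by omega)
      exact ⟨hT, by omega⟩
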